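/- All graphs are finite, undirected and simple. A connected graph $\Gamma$ of diameter $D$ is *distance-regular* if there are integers $b_i,c_i$ $(0\le i\le D)$ such that for any two vertices $x,y$ at distance $i$ there are exactly $c_i$ neighbours of $y$ at distance $i-1$ from $x$ and exactly $b_i$ neighbours of $y$ at distance $i+1$ from $x$ (so $c_0=b_D=0$). A *Terwilliger graph* is a connected non-complete graph for which there is a fixed $\mu\ge 1$ such that for any two vertices $u,v$ at distance two the common neighbours of $u$ and $v$ form a clique of size $\mu$. The eigenvalues of a graph are those of its adjacency matrix, and its second largest eigenvalue is the second largest of its distinct eigenvalues. Let $T\ge 1$ be a real number. Then, up to isomorphism, there are only finitely many distance-regular Terwilliger graphs with $c_2\ge 2$ and second largest eigenvalue at least $\frac{b_1}{T}-1$. -/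

import Mathlib

namespace DRG

/-- `G` is a distance-regular graph with intersection numbers `b i`, `c i`: it is connected, and
for all vertices `x`, `y` at distance `i` there are exactly `b i` neighbours of `y` at distance
`i + 1` from `x`, and exactly `c i` neighbours of `y` at distance `i - 1` from `x` (none if
`i = 0`). Only the values `b i`, `c i` with `i` at most the diameter are constrained; `c 0 = 0`
and `b i = 0` for `i` the diameter are forced. -/
def IsDistanceRegularWith {V : Type*} (G : SimpleGraph V) (b c : ℕ → ℕ) : Prop :=
  G.Connected ∧ ∀ x y : V,
    {z | G.Adj y z ∧ G.dist x z = G.dist x y + 1}.ncard = b (G.dist x y) ∧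
    {z | G.Adj y z ∧ G.dist x z + 1 = G.dist x y}.ncard = c (G.dist x y)

/-- A Terwilliger graph: connected, not complete, and for some fixed `μ ≥ 1` the common neighbours
of any two vertices at distance two form a clique of size `μ`. -/
def IsTerwilliger {V : Type*} (G : SimpleGraph V) : Prop :=
  G.Connected ∧ G ≠ ⊤ ∧ ∃ μ : ℕ, 1 ≤ μ ∧ ∀ u v : V, G.dist u v = 2 →
    G.IsClique (G.commonNeighbors u v) ∧ (G.commonNeighbors u v).ncard = μ

open Classical in
/-- `θ` is an eigenvalue of `G`, i.e. of its real adjacency matrix. -/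
def IsEigenvalue {V : Type*} [Fintype V] (G : SimpleGraph V) (θ : ℝ) : Prop :=
  Module.End.HasEigenvalue (Matrix.toLin' (G.adjMatrix ℝ)) θ

/-- `θ` is the second largest among the distinct eigenvalues of `G`: the largest of those
eigenvalues that are smaller than some other eigenvalue. -/
def IsSecondLargestEigenvalue {V : Type*} [Fintype V] (G : SimpleGraph V) (θ : ℝ) : Prop :=
  IsGreatest {t : ℝ | IsEigenvalue G t ∧ ∃ s : ℝ, IsEigenvalue G s ∧ t < s} θ

end DRG

/-! It suffices to bound the number of vertices, and this follows from a bound on the valency `b 0`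
and a bound on the diameter in terms of the valency.

Valency (`valency_le`). Fix a vertex `x` and let `Δ` be the graph induced on its `b 0` neighbours.
If `q` is the minimal polynomial of the adjacency matrix `A` divided by `X - θ`, then `q(A)²` is
positive semidefinite and its entries depend only on the distance. Restricted to the neighbours of
`x` it is a combination of the identity, the adjacency matrix of `Δ` and the all-ones matrix, which
shows that `Δ` has no eigenvalue below `-1 - T` (`local_adjForm_ge`). By the Terwilliger condition
any two nonadjacent vertices of `Δ` have exactly `c 2 - 1 ≥ 1` common neighbours, and these form a
clique. A regular non-complete graph of this kind is bounded (`HasCliqueCommonNeighbors.card_le`):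
the eigenvalue bound limits claws, so boundedly many cliques cover each neighbourhood; hence the
degree and the number of vertices are at most constant multiples of `c 2 - 1`, and boundedly many
cliques cover everything. This yields two cliques with no edges between them, both completely joined
to a third, all of size proportional to the number of vertices. Large cliques so placed force a very
negative eigenvalue.

Diameter (`dist_lt_of_two_le_c_two`), in the manner of Ivanov's bound. If `b` and `c` are constant
from `i ≥ 2` to `3i`, they keep the same values at `i - 1`. Descending to `i = 1` gives `c 1 = c 3`,
which is impossible as `c 1 = 1 < c 2`. So `c - b` grows whenever the distance triples, while it
stays between `-b 0` and `b 0`. -/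

namespace DRG

/-! ### Distances, geodesics and the diameter of a distance-regular graph. -/

section DiameterBound

variable {V : Type*} {G : SimpleGraph V} {b c : ℕ → ℕ}

/-- The neighbours of `y` that are closer to `x` than `y` is. -/
def nearer (G : SimpleGraph V) (x y : V) : Set V :=
  {z | G.Adj y z ∧ G.dist x z + 1 = G.dist x y}

/-- The neighbours of `y` that are farther from `x` than `y` is. -/
def farther (G : SimpleGraph V) (x y : V) : Set V :=
  {z | G.Adj y z ∧ G.dist x z = G.dist x y + 1}

theorem IsDistanceRegularWith.ncard_nearer (hG : IsDistanceRegularWith G b c) (x y : V) :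
    (nearer G x y).ncard = c (G.dist x y) := (hG.2 x y).2

theorem IsDistanceRegularWith.ncard_farther (hG : IsDistanceRegularWith G b c) (x y : V) :
    (farther G x y).ncard = b (G.dist x y) := (hG.2 x y).1

theorem dist_le_succ_of_adj (hc : G.Connected) (x : V) {y z : V} (h : G.Adj y z) :
    G.dist x z ≤ G.dist x y + 1 := by
  have := hc.dist_triangle (u := x) (v := y) (w := z)
  rwa [SimpleGraph.dist_eq_one_iff_adj.2 h] at this

theorem nearer_subset_of_between (hc : G.Connected) {x x' y : V}
    (h : G.dist x y = G.dist x x' + G.dist x' y) : nearer G x' y ⊆ nearer G x y := by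
  rintro z ⟨hz, hd⟩
  refine ⟨hz, ?_⟩
  have := hc.dist_triangle (u := x) (v := x') (w := z)
  have := dist_le_succ_of_adj hc x hz.symm
  omega

theorem farther_subset_of_between (hc : G.Connected) {x x' y : V}
    (h : G.dist x y = G.dist x x' + G.dist x' y) : farther G x y ⊆ farther G x' y := by
  rintro z ⟨hz, hd⟩
  refine ⟨hz, ?_⟩
  have := hc.dist_triangle (u := x) (v := x') (w := z)
  have := dist_le_succ_of_adj hc x' hz
  omega

theorem exists_mem_nearer (hc : G.Connected) {x y : V} (h : 0 < G.dist x y) :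
    ∃ z, z ∈ nearer G x y := by
  obtain ⟨p, hp⟩ := hc.exists_walk_length_eq_dist y x
  rw [SimpleGraph.dist_comm] at hp
  cases p with
  | nil => simp at h
  | @cons _ z _ hz q =>
    refine ⟨z, hz, ?_⟩
    have h1 := SimpleGraph.dist_le q
    rw [SimpleGraph.dist_comm] at h1
    have h2 := dist_le_succ_of_adj hc x hz.symm
    simp only [SimpleGraph.Walk.length_cons] at hp
    omega

theorem exists_between (hc : G.Connected) {x y : V} {n : ℕ} (h : n ≤ G.dist x y) :
    ∃ z, G.dist x z = n ∧ n + G.dist z y = G.dist x y := by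
  obtain ⟨m, hm⟩ := Nat.exists_eq_add_of_le h
  induction m generalizing y with
  | zero => exact ⟨y, by simpa using hm, by simp; omega⟩
  | succ m ih =>
    obtain ⟨y', hy', hd⟩ := exists_mem_nearer hc (x := x) (y := y) (by omega)
    obtain ⟨z, hz, hz'⟩ := ih (y := y') (by omega) (by omega)
    refine ⟨z, hz, ?_⟩
    have := dist_le_succ_of_adj hc z hy'.symm
    have := hc.dist_triangle (u := x) (v := z) (w := y)
    omega

theorem exists_dist_eq_of_le (hc : G.Connected) {N : ℕ} (hN : ∃ x y, G.dist x y = N) {n : ℕ}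
    (hn : n ≤ N) : ∃ x y, G.dist x y = n := by
  obtain ⟨x, y, rfl⟩ := hN
  obtain ⟨z, hz, -⟩ := exists_between hc hn
  exact ⟨x, z, hz⟩

variable [Finite V]

/-- An inclusion between finite sets of equal size is an equality. Constancy of `c`, and likewise of
`b` in the next lemma, enters the combinatorics below mainly through such equalities. -/
theorem nearer_eq_of_between (hG : IsDistanceRegularWith G b c) {x x' y : V}
    (h : G.dist x y = G.dist x x' + G.dist x' y) (he : c (G.dist x' y) = c (G.dist x y)) :
    nearer G x' y = nearer G x y :=
  Set.eq_of_subset_of_ncard_le (nearer_subset_of_between hG.1 h)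
    (by rw [hG.ncard_nearer, hG.ncard_nearer, he]) (Set.toFinite _)

theorem farther_eq_of_between (hG : IsDistanceRegularWith G b c) {x x' y : V}
    (h : G.dist x y = G.dist x x' + G.dist x' y) (he : b (G.dist x' y) = b (G.dist x y)) :
    farther G x y = farther G x' y :=
  Set.eq_of_subset_of_ncard_le (farther_subset_of_between hG.1 h)
    (by rw [hG.ncard_farther, hG.ncard_farther, he]) (Set.toFinite _)

section Monotone

variable {N : ℕ}

theorem IsDistanceRegularWith.c_mono (hG : IsDistanceRegularWith G b c)
    (hN : ∃ x y, G.dist x y = N) {i j : ℕ} (hij : i ≤ j) (hj : j ≤ N) : c i ≤ c j := by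
  obtain ⟨x, y, hxy⟩ := exists_dist_eq_of_le hG.1 hN hj
  obtain ⟨z, hz, hz'⟩ := exists_between hG.1 (x := x) (y := y) (n := j - i) (by omega)
  have := Set.ncard_le_ncard (nearer_subset_of_between hG.1 (x := x) (x' := z) (y := y) (by omega))
    (Set.toFinite _)
  rwa [hG.ncard_nearer, hG.ncard_nearer, hxy, show G.dist z y = i by omega] at this

theorem IsDistanceRegularWith.b_anti (hG : IsDistanceRegularWith G b c)
    (hN : ∃ x y, G.dist x y = N) {i j : ℕ} (hij : i ≤ j) (hj : j ≤ N) : b j ≤ b i := by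
  obtain ⟨x, y, hxy⟩ := exists_dist_eq_of_le hG.1 hN hj
  obtain ⟨z, hz, hz'⟩ := exists_between hG.1 (x := x) (y := y) (n := j - i) (by omega)
  have := Set.ncard_le_ncard (farther_subset_of_between hG.1 (x := x) (x' := z) (y := y) (by omega))
    (Set.toFinite _)
  rwa [hG.ncard_farther, hG.ncard_farther, hxy, show G.dist z y = i by omega] at this

theorem IsDistanceRegularWith.b_pos (hG : IsDistanceRegularWith G b c)
    (hN : ∃ x y, G.dist x y = N) {n : ℕ} (hn : n < N) : 0 < b n := by
  obtain ⟨x, y, hxy⟩ := exists_dist_eq_of_le hG.1 hN (n := n + 1) hn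
  obtain ⟨z, hz, hz'⟩ := exists_mem_nearer hG.1 (x := x) (y := y) (by omega)
  have : (farther G x z).ncard = b n := by rw [hG.ncard_farther]; congr 1; omega
  rw [← this, Set.ncard_pos (Set.toFinite _)]
  exact ⟨y, hz.symm, by omega⟩

theorem IsDistanceRegularWith.exists_extend (hG : IsDistanceRegularWith G b c)
    (hN : ∃ x y, G.dist x y = N) {x y : V} {m : ℕ} (hm : G.dist x y + m ≤ N) :
    ∃ z, G.dist x z = G.dist x y + m ∧ G.dist y z = m := by
  induction m with
  | zero => exact ⟨y, by simp⟩
  | succ m ih =>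
    obtain ⟨z, hz, hz'⟩ := ih (by omega)
    have hb := hG.b_pos hN (n := G.dist x z) (by omega)
    rw [← hG.ncard_farther, Set.ncard_pos (Set.toFinite _)] at hb
    obtain ⟨w, hw, hd⟩ := hb
    have := dist_le_succ_of_adj hG.1 y hw
    have := hG.1.dist_triangle (u := x) (v := y) (w := w)
    exact ⟨w, by omega, by omega⟩

end Monotone

/-! ### Ranges of distances on which `b` and `c` are constant. -/

section Zone

variable {i : ℕ}

/-- If `c` is constant between `i` and `2i - 1`, certain closed walks of length `2i`
are excluded. -/
theorem dist_ne_of_even_circuit (hG : IsDistanceRegularWith G b c) (hi : 2 ≤ i)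
    (hN : ∃ x y, G.dist x y = 2 * i - 1)
    (hcc : ∀ j, i ≤ j → j ≤ 2 * i - 1 → c j = c i) {x w u v : V}
    (hxw : G.Adj x w) (huv : G.Adj u v) (hxv : G.dist x v = i) (hwv : G.dist w v + 1 = i)
    (hxu : G.dist x u + 1 = i) : G.dist w u ≠ i := by
  intro hwu
  have hc := hG.1
  -- Prolong a geodesic from `x` through `v` to `Y` at distance `2i - 1`. As `c` takes the same
  -- value at `i` and `2i - 1`, every `z` with distances `i` from `x` and `i - 1` from `Y` satisfies
  -- `nearer G z x = nearer G Y x`. This forces `nearer G Y u = nearer G w u`; but a neighbour of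
  -- `u` nearer to `x` lies in the second set, and in the first it would put `Y` within `2i - 3` of
  -- `x`.
  obtain ⟨Y, hY, hvY⟩ := hG.exists_extend hN (x := x) (y := v) (m := i - 1) (by omega)
  have huY : G.dist u Y = i := by
    have := dist_le_succ_of_adj hc Y huv.symm
    have := hc.dist_triangle (u := x) (v := u) (w := Y)
    rw [G.dist_comm (u := Y), G.dist_comm (u := Y)] at *
    omega
  have hsub : nearer G Y u ⊆ nearer G w u := by
    rintro v' ⟨hv', hd⟩
    refine ⟨hv', ?_⟩
    have h1 := dist_le_succ_of_adj hc x hv'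
    have h2 := hc.dist_triangle (u := x) (v := v') (w := Y)
    rw [G.dist_comm (u := Y), G.dist_comm (u := Y)] at hd
    have hxv' : G.dist x v' = i := by omega
    have key : ∀ z, G.dist x z = i → G.dist z Y + 1 = i → nearer G z x = nearer G Y x := by
      intro z hz hz'
      apply nearer_eq_of_between hG
      · have := G.dist_comm (u := Y) (v := x)
        have := G.dist_comm (u := Y) (v := z)
        have := G.dist_comm (u := z) (v := x)
        omega
      · rw [G.dist_comm (u := z), hz, G.dist_comm (u := Y), hcc (G.dist x Y) (by omega) (by omega)]
    have hw : w ∈ nearer G v x := ⟨hxw, by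
      rw [G.dist_comm (u := v), G.dist_comm (u := v)]; omega⟩
    rw [key v hxv (by omega), ← key v' hxv' (by omega)] at hw
    have := hw.2
    rw [G.dist_comm (u := v'), G.dist_comm (u := v')] at this
    omega
  have heq := Set.eq_of_subset_of_ncard_le hsub
    (by rw [hG.ncard_nearer, hG.ncard_nearer, hwu, G.dist_comm (u := Y), huY]) (Set.toFinite _)
  obtain ⟨u', hu', hd⟩ := exists_mem_nearer hc (x := x) (y := u) (by omega)
  have hmem : u' ∈ nearer G w u := by
    refine ⟨hu', ?_⟩
    have h1 := hc.dist_triangle (u := w) (v := x) (w := u')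
    rw [SimpleGraph.dist_eq_one_iff_adj.2 hxw.symm] at h1
    have := dist_le_succ_of_adj hc w hu'.symm
    omega
  rw [← heq] at hmem
  have h1 := hmem.2
  rw [G.dist_comm (u := Y), G.dist_comm (u := Y)] at h1
  have := hc.dist_triangle (u := x) (v := u') (w := Y)
  omega

/-- The set `farther G v y` is the same for adjacent `v`, `v'` in a range of distances from `y`
where `b` and `c` are constant. -/
theorem farther_eq_of_adj (hG : IsDistanceRegularWith G b c) {R : ℕ} {y v v' : V}
    (hcc : ∀ j, i ≤ j → j ≤ R + 1 → c j = c i) (hbb : ∀ j, i ≤ j → j ≤ R → b j = b i)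
    (hadj : G.Adj v v') (h1 : i ≤ G.dist y v) (h2 : G.dist y v ≤ R)
    (h1' : i ≤ G.dist y v') (h2' : G.dist y v' ≤ R) : farther G v y = farther G v' y := by
  have hc := hG.1
  have flat : ∀ {p q : V}, G.Adj p q → i ≤ G.dist y p → G.dist y p ≤ R →
      G.dist y p = G.dist y q → farther G p y ⊆ farther G q y := by
    rintro p q hpq hp1 hp2 he z ⟨hz, hd⟩
    refine ⟨hz, ?_⟩
    have e1 := dist_le_succ_of_adj hc z hpq.symm
    have e2 := dist_le_succ_of_adj hc q hz
    have s1 := G.dist_comm (u := p) (v := z)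
    have s2 := G.dist_comm (u := q) (v := z)
    have s3 := G.dist_comm (u := p) (v := y)
    have s4 := G.dist_comm (u := q) (v := y)
    -- Otherwise `q` is nearer to `z` than `p` is. Constancy of `c` gives `nearer G y p = nearer G z
    -- p`, so `q` would also be nearer to `y`, although `p` and `q` are at the same distance from
    -- `y`.
    by_contra hne
    have hzp : G.dist z p = G.dist y p + 1 := by omega
    have hq : q ∈ nearer G z p := ⟨hpq, by omega⟩
    rw [← nearer_eq_of_between hG (x := z) (x' := y) (y := p)
      (by rw [SimpleGraph.dist_eq_one_iff_adj.2 hz.symm]; omega)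
      (by rw [hzp, hcc _ hp1 (by omega), hcc (G.dist y p + 1) (by omega) (by omega)])] at hq
    have := hq.2
    omega
  have up : ∀ {p q : V}, G.Adj p q → i ≤ G.dist y p → G.dist y q ≤ R →
      G.dist y q = G.dist y p + 1 → farther G q y = farther G p y := by
    intro p q hpq hp1 hp2 he
    apply farther_eq_of_between hG
    · rw [SimpleGraph.dist_eq_one_iff_adj.2 hpq.symm, G.dist_comm (u := q), G.dist_comm (u := p)]
      omega
    · rw [G.dist_comm (u := q), G.dist_comm (u := p), hbb _ hp1 (by omega), hbb _ (by omega) hp2]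
  have e1 := dist_le_succ_of_adj hc y hadj
  have e2 := dist_le_succ_of_adj hc y hadj.symm
  rcases (by omega : G.dist y v = G.dist y v' ∨ G.dist y v' = G.dist y v + 1 ∨
      G.dist y v = G.dist y v' + 1) with h | h | h
  · exact (flat hadj h1 h2 h).antisymm (flat hadj.symm h1' h2' h.symm)
  · exact (up hadj h1 h2' h).symm
  · exact up hadj.symm h1' h2 h

/-- Vertices `v`, `v'` with different sets `farther G v y`, `farther G v' y` are only joined by
geodesics that come close to `y`. -/
theorem dist_ge_of_farther_ne (hG : IsDistanceRegularWith G b c) {R : ℕ} {y v v' : V}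
    (hcc : ∀ j, i ≤ j → j ≤ R + 1 → c j = c i) (hbb : ∀ j, i ≤ j → j ≤ R → b j = b i)
    (h1 : i ≤ G.dist y v) (h2 : G.dist y v + G.dist v v' ≤ R)
    (hne : farther G v y ≠ farther G v' y) :
    G.dist y v + G.dist y v' ≤ G.dist v v' + 2 * (i - 1) := by
  have hc := hG.1
  -- The set `farther G · y` does not change along edges that stay at distance at least `i` from
  -- `y`, so a geodesic from `v` to `v'` has to pass through some `g` at distance `i - 1`. The bound
  -- by `R` keeps the geodesic inside the constant range.
  suffices h : ∃ g, G.dist y g + 1 = i ∧ G.dist v g + G.dist g v' = G.dist v v' by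
    obtain ⟨g, hg, hg'⟩ := h
    have := hc.dist_triangle (u := y) (v := g) (w := v)
    have := hc.dist_triangle (u := y) (v := g) (w := v')
    rw [G.dist_comm (u := g) (v := v)] at *
    omega
  obtain ⟨n, hn⟩ : ∃ n, G.dist v v' = n := ⟨_, rfl⟩
  induction n generalizing v with
  | zero =>
    rw [hc.dist_eq_zero_iff] at hn
    exact absurd (by rw [hn]) hne
  | succ n ih =>
    obtain ⟨p, hp, hd⟩ := exists_mem_nearer hc (x := v') (y := v)
      (by rw [G.dist_comm]; omega)
    rw [G.dist_comm (u := v'), G.dist_comm (u := v')] at hd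
    have e1 := dist_le_succ_of_adj hc y hp
    have e2 := dist_le_succ_of_adj hc y hp.symm
    by_cases hpi : i ≤ G.dist y p
    · rw [farther_eq_of_adj hG hcc hbb hp h1 (by omega) hpi (by omega)] at hne
      obtain ⟨g, hg, hg'⟩ := ih hpi (by omega) hne (by omega)
      refine ⟨g, hg, ?_⟩
      have := hc.dist_triangle (u := v) (v := p) (w := g)
      rw [SimpleGraph.dist_eq_one_iff_adj.2 hp] at this
      have := hc.dist_triangle (u := v) (v := g) (w := v')
      omega
    · refine ⟨p, by omega, ?_⟩
      rw [SimpleGraph.dist_eq_one_iff_adj.2 hp]; omega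

/-- Inside a range where `b` and `c` are constant, all farther neighbours `u` of a vertex `h` at
distance `i - 1` from `y` have the same set `farther G u y`, if `b` drops at `i`. -/
theorem farther_eq_of_mem_farther (hG : IsDistanceRegularWith G b c) (hi : 2 ≤ i)
    (hN : ∃ x y, G.dist x y = 2 * i - 1)
    (hcc : ∀ j, i ≤ j → j ≤ 2 * i + 1 → c j = c i) (hbb : ∀ j, i ≤ j → j ≤ 2 * i → b j = b i)
    (hlt : b i < b (i - 1)) {y h u u' : V} (hyh : G.dist y h + 1 = i)
    (hu : u ∈ farther G y h) (hu' : u' ∈ farther G y h) : farther G u y = farther G u' y := by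
  by_contra hne
  have hc := hG.1
  obtain ⟨hhu, hyu⟩ := hu
  obtain ⟨hhu', hyu'⟩ := hu'
  have sep : ∀ {v v' : V}, i ≤ G.dist y v → G.dist y v + G.dist v v' ≤ 2 * i →
      farther G v y ≠ farther G v' y →
      G.dist y v + G.dist y v' ≤ G.dist v v' + 2 * (i - 1) :=
    fun h1 h2 h3 => dist_ge_of_farther_ne hG hcc hbb h1 h2 h3
  have edge : ∀ {v v' : V}, G.Adj v v' → i ≤ G.dist y v → G.dist y v ≤ 2 * i →
      i ≤ G.dist y v' → G.dist y v' ≤ 2 * i → farther G v y = farther G v' y :=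
    fun h0 h1 h2 h3 h4 => farther_eq_of_adj hG hcc hbb h0 h1 h2 h3 h4
  have hhu1 := SimpleGraph.dist_eq_one_iff_adj.2 hhu
  have hhu1' := SimpleGraph.dist_eq_one_iff_adj.2 hhu'
  -- `e` lies beyond `u` on a geodesic from `y`, so it has the same farther set as `u`. The distance
  -- `2i - 2` makes `sep` tight for `u'` and `e`: it forces distance exactly `i` between them, and
  -- `i - 1` between `h` and `e`.
  obtain ⟨e, hye, hue⟩ := hG.exists_extend hN (x := y) (y := u) (m := i - 2) (by omega)
  have hβe : farther G e y = farther G u y := by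
    apply farther_eq_of_between hG
    · have := G.dist_comm (u := e) (v := y)
      have := G.dist_comm (u := e) (v := u)
      have := G.dist_comm (u := u) (v := y)
      omega
    · rw [G.dist_comm (u := u), G.dist_comm (u := e), hbb (G.dist y u) (by omega) (by omega),
        hbb (G.dist y e) (by omega) (by omega)]
  have hhe : G.dist h e ≤ i - 1 := by
    have := hc.dist_triangle (u := h) (v := u) (w := e)
    omega
  have hu'e : G.dist u' e = i := by
    have h1 := hc.dist_triangle (u := u') (v := h) (w := e)
    rw [G.dist_comm (u := u') (v := h)] at h1
    have h2 := sep (v := u') (v' := e) (by omega) (by omega) (by rw [hβe]; exact Ne.symm hne)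
    omega
  have hhe' : G.dist h e + 1 = i := by
    have h1 := hc.dist_triangle (u := u') (v := h) (w := e)
    rw [G.dist_comm (u := u') (v := h)] at h1
    omega
  have hA : nearer G e u' = nearer G y u' := by
    refine Set.eq_of_subset_of_ncard_le ?_ ?_ (Set.toFinite _)
    · rintro f ⟨hf, hfd⟩
      have s1 := G.dist_comm (u := e) (v := f)
      have s2 := G.dist_comm (u := e) (v := u')
      refine ⟨hf, ?_⟩
      have l1 := dist_le_succ_of_adj hc y hf
      have l2 := dist_le_succ_of_adj hc y hf.symm
      by_contra hcon
      have hβf := edge hf (by omega) (by omega) (by omega) (by omega)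
      have := sep (v := f) (v' := e) (by omega) (by omega) (by
        rw [← hβf, hβe]; exact Ne.symm hne)
      omega
    · rw [hG.ncard_nearer, hG.ncard_nearer, G.dist_comm (u := e), hu'e,
        hcc (G.dist y u') (by omega) (by omega)]
  have hB : nearer G u' e = nearer G y e := by
    refine Set.eq_of_subset_of_ncard_le ?_ ?_ (Set.toFinite _)
    · rintro g ⟨hg, hgd⟩
      refine ⟨hg, ?_⟩
      have l1 := dist_le_succ_of_adj hc y hg
      have l2 := dist_le_succ_of_adj hc y hg.symm
      by_contra hcon
      have hβg := edge hg (by omega) (by omega) (by omega) (by omega)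
      have := sep (v := u') (v' := g) (by omega) (by omega) (by
        rw [← hβg, hβe]; exact Ne.symm hne)
      omega
    · rw [hG.ncard_nearer, hG.ncard_nearer, hu'e, hcc (G.dist y e) (by omega) (by omega)]
  -- The assumed drop of `b` supplies a neighbour `e'` of `e` which is farther from `h` but not from
  -- `u'`; the circuit lemma then leaves only distance `i` between `u'` and `e'`.
  obtain ⟨e', ⟨hee', hhe2⟩, hnot⟩ : ∃ e' ∈ farther G h e, e' ∉ farther G u' e := by
    apply Set.exists_mem_notMem_of_ncard_lt_ncard _ (Set.toFinite _)
    rw [hG.ncard_farther, hG.ncard_farther, hu'e, show G.dist h e = i - 1 by omega]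
    exact hlt
  have hu'e'1 : G.dist u' e' ≠ i + 1 := fun h => hnot ⟨hee', by omega⟩
  have t1 := dist_le_succ_of_adj hc u' hee'
  have t2 := dist_le_succ_of_adj hc u' hee'.symm
  have hu'e'2 : G.dist u' e' + 1 ≠ i := fun h =>
    dist_ne_of_even_circuit hG hi hN (fun j h1 h2 => hcc j h1 (by omega)) hhu'.symm hee'.symm
      hu'e hhe' h (by omega)
  have hu'e' : G.dist u' e' = i := by omega
  -- `h` is nearer to `e` than `u'` is, but not nearer to `e'`, so the two sets differ although they
  -- have equal size. By `hA` and `hB`, neither `f` nor `e'` steps towards `y`; being only `i - 1`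
  -- apart, they violate `sep`.
  obtain ⟨f, ⟨hf, hfd⟩, hfn⟩ : ∃ f ∈ nearer G e' u', f ∉ nearer G e u' := by
    by_contra hcon
    push Not at hcon
    have heq := Set.eq_of_subset_of_ncard_le (s := nearer G e' u') (t := nearer G e u') hcon
      (by rw [hG.ncard_nearer, hG.ncard_nearer, G.dist_comm (u := e), G.dist_comm (u := e'), hu'e,
        hu'e']) (Set.toFinite _)
    have hh : h ∈ nearer G e u' := ⟨hhu'.symm, by
      rw [G.dist_comm (u := e), G.dist_comm (u := e)]; omega⟩
    rw [← heq] at hh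
    have := hh.2
    have := G.dist_comm (u := e') (v := h)
    have := G.dist_comm (u := e') (v := u')
    omega
  have s1 := G.dist_comm (u := e') (v := f)
  have s2 := G.dist_comm (u := e') (v := u')
  have l1 := dist_le_succ_of_adj hc y hf
  have l2 := dist_le_succ_of_adj hc y hf.symm
  have m1 := dist_le_succ_of_adj hc y hee'
  have m2 := dist_le_succ_of_adj hc y hee'.symm
  have hflev : G.dist y f + 1 ≠ G.dist y u' := fun h => hfn (by rw [hA]; exact ⟨hf, h⟩)
  have he'lev : G.dist y e' + 1 ≠ G.dist y e := fun h => by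
    have hm : e' ∈ nearer G u' e := by rw [hB]; exact ⟨hee', h⟩
    have := hm.2
    omega
  have hβf := edge hf (by omega) (by omega) (by omega) (by omega)
  have hβe' := edge hee' (by omega) (by omega) (by omega) (by omega)
  have := sep (v := f) (v' := e') (by omega) (by omega) (by
    rw [← hβf, ← hβe', hβe]; exact Ne.symm hne)
  omega

/-- If `b` dropped at `i`, a `y'` beyond `y` as seen from one `u` in `farther G y h` would be beyond
`y` as seen from all of them, by `farther_eq_of_mem_farther`. Then `farther G y h ⊆ farther G y' h`
with `h` at distances `i - 1` and `i`, so `b` does not drop after all. -/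
theorem b_pred_eq_of_constant (hG : IsDistanceRegularWith G b c) (hi : 2 ≤ i)
    (hN : ∃ x y, G.dist x y = 2 * i - 1)
    (hcc : ∀ j, i ≤ j → j ≤ 2 * i + 1 → c j = c i)
    (hbb : ∀ j, i ≤ j → j ≤ 2 * i → b j = b i) : b (i - 1) = b i := by
  have hc := hG.1
  refine le_antisymm ?_ (hG.b_anti hN (by omega) (by omega))
  by_contra hlt
  push Not at hlt
  obtain ⟨y, h, hyh⟩ := exists_dist_eq_of_le hc hN (n := i - 1) (by omega)
  have hb1 : 0 < b (G.dist y h) := hG.b_pos hN (by omega)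
  rw [← hG.ncard_farther, Set.ncard_pos (Set.toFinite _)] at hb1
  obtain ⟨u, hu⟩ := hb1
  have hyu := hu.2
  have hb2 : 0 < b (G.dist u y) := by
    rw [G.dist_comm]; exact hG.b_pos hN (by omega)
  rw [← hG.ncard_farther, Set.ncard_pos (Set.toFinite _)] at hb2
  obtain ⟨y', hy'⟩ := hb2
  have hhy' : G.dist y' h = i := by
    have h1 := dist_le_succ_of_adj hc h hy'.1
    have h2 := dist_le_succ_of_adj hc y' hu.1
    have h3 := hy'.2
    have := G.dist_comm (u := h) (v := y')
    have := G.dist_comm (u := u) (v := y')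
    have := G.dist_comm (u := h) (v := y)
    have := G.dist_comm (u := u) (v := y)
    omega
  have hsub : farther G y h ⊆ farther G y' h := by
    intro u' hu'
    refine ⟨hu'.1, ?_⟩
    have hm : y' ∈ farther G u' y := by
      rw [← farther_eq_of_mem_farther hG hi hN hcc hbb hlt (by omega) hu hu']; exact hy'
    have h1 := hm.2
    have h2 := hu'.2
    have := G.dist_comm (u := u') (v := y')
    have := G.dist_comm (u := u') (v := y)
    omega
  have := Set.ncard_le_ncard hsub (Set.toFinite _)
  rw [hG.ncard_farther, hG.ncard_farther, hhy', hyh] at this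
  omega

-- If `c` rose at `i`, some neighbour `w` of `x` would be nearer to `v` but not to the predecessor
-- `u` of `v`; the circuit lemma puts `w` at distance `i - 1` from `u`. With `Y` beyond `v`,
-- comparing farther sets at `w` gives `w'` farther from `u` but not from `Y`, and comparing nearer
-- sets at `u` gives `v'`, halfway from `w` to `Y`, with `w'` farther from `v'`. Constancy of `b`
-- then makes `w'` farther from `Y`, a contradiction.
set_option maxHeartbeats 1000000 in
theorem c_pred_eq_of_constant (hG : IsDistanceRegularWith G b c) (hi : 2 ≤ i)
    (hN : ∃ x y, G.dist x y = 2 * i - 1)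
    (hcc : ∀ j, i ≤ j → j ≤ 2 * i - 1 → c j = c i)
    (hbb : b (2 * i - 2) = b (i - 1)) : c (i - 1) = c i := by
  have hc := hG.1
  refine le_antisymm (hG.c_mono hN (by omega) (by omega)) ?_
  by_contra hlt
  push Not at hlt
  obtain ⟨x, v, hxv⟩ := exists_dist_eq_of_le hc hN (n := i) (by omega)
  obtain ⟨u, hvu, hxu⟩ := exists_mem_nearer hc (x := x) (y := v) (by omega)
  have sxv := G.dist_comm (u := v) (v := x)
  have sxu := G.dist_comm (u := u) (v := x)
  obtain ⟨w, hw, hwn⟩ : ∃ w ∈ nearer G v x, w ∉ nearer G u x := by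
    apply Set.exists_mem_notMem_of_ncard_lt_ncard _ (Set.toFinite _)
    rw [hG.ncard_nearer, hG.ncard_nearer, sxv, hxv, show G.dist u x = i - 1 by omega]
    exact hlt
  have hxw := hw.1
  have hvw := hw.2
  have swv := G.dist_comm (u := w) (v := v)
  have swu := G.dist_comm (u := w) (v := u)
  have hwu1 := dist_ne_of_even_circuit hG hi hN hcc hxw hvu.symm hxv (by omega) (by omega)
  have hwu2 : G.dist u w + 1 ≠ G.dist u x := fun h => hwn ⟨hxw, h⟩
  have hwu : G.dist u w + 1 = i := by
    have := dist_le_succ_of_adj hc u hxw.symm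
    have := dist_le_succ_of_adj hc w hvu
    omega
  obtain ⟨Y, hxY, hvY⟩ := hG.exists_extend hN (x := x) (y := v) (m := i - 1) (by omega)
  have sYx := G.dist_comm (u := Y) (v := x)
  have sYv := G.dist_comm (u := Y) (v := v)
  have sYu := G.dist_comm (u := Y) (v := u)
  have key : ∀ z, G.dist x z = i → G.dist z Y + 1 = i → nearer G z x = nearer G Y x := by
    intro z hz hz'
    have s1 := G.dist_comm (u := Y) (v := z)
    have s2 := G.dist_comm (u := z) (v := x)
    apply nearer_eq_of_between hG (by omega)
    rw [s2, hz, sYx, hcc (G.dist x Y) (by omega) (by omega)]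
  have hYw : G.dist Y w = 2 * i - 2 := by
    have := hw
    rw [key v hxv (by omega)] at this
    have := this.2
    omega
  have huY : G.dist u Y = i := by
    have := dist_le_succ_of_adj hc Y hvu
    have := hc.dist_triangle (u := x) (v := u) (w := Y)
    omega
  have hfar : ∀ {v'}, v' ∈ nearer G Y u → G.dist w v' + 1 = i ∧ G.dist v' Y + 1 = i := by
    rintro v' ⟨hv', hd⟩
    have h1 := dist_le_succ_of_adj hc x hv'
    have h2 := hc.dist_triangle (u := x) (v := v') (w := Y)
    have s1 := G.dist_comm (u := Y) (v := v')
    have hxv' : G.dist x v' = i := by omega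
    have hw' := hw
    rw [key v hxv (by omega), ← key v' hxv' (by omega)] at hw'
    have := hw'.2
    have s2 := G.dist_comm (u := v') (v := w)
    have s3 := G.dist_comm (u := v') (v := x)
    omega
  obtain ⟨w', ⟨hww', huw'⟩, hw'n⟩ : ∃ w' ∈ farther G u w, w' ∉ farther G Y w := by
    by_contra hcon
    push Not at hcon
    have heq := Set.eq_of_subset_of_ncard_le (s := farther G u w) (t := farther G Y w) hcon
      (by rw [hG.ncard_farther, hG.ncard_farther, hYw, show G.dist u w = i - 1 by omega, hbb])
      (Set.toFinite _)
    have hx : x ∈ farther G Y w := ⟨hxw.symm, by omega⟩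
    rw [← heq] at hx
    have := hx.2
    omega
  have suw' := G.dist_comm (u := w') (v := u)
  obtain ⟨v', hv', hv'd⟩ : ∃ v' ∈ nearer G Y u, G.dist w' v' ≠ i - 1 := by
    by_contra hcon
    push Not at hcon
    have hsub : nearer G Y u ⊆ nearer G w' u := fun v' hv' =>
      ⟨hv'.1, by have := hcon v' hv'; omega⟩
    have heq := Set.eq_of_subset_of_ncard_le hsub
      (by rw [hG.ncard_nearer, hG.ncard_nearer, suw', huw', sYu, huY,
        show G.dist u w + 1 = i by omega]) (Set.toFinite _)
    obtain ⟨g, hg⟩ := exists_mem_nearer hc (x := w) (y := u) (by omega)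
    have hg' : g ∈ nearer G w' u := nearer_subset_of_between hc
      (by rw [SimpleGraph.dist_eq_one_iff_adj.2 hww'.symm]; omega) hg
    rw [← heq] at hg'
    have h1 := hg'.2
    have h2 := hg.2
    have h3 := hc.dist_triangle (u := Y) (v := g) (w := w)
    have := G.dist_comm (u := g) (v := w)
    omega
  obtain ⟨hwv', hv'Y⟩ := hfar hv'
  have sv'w := G.dist_comm (u := v') (v := w)
  have sv'w' := G.dist_comm (u := v') (v := w')
  have sv'Y := G.dist_comm (u := v') (v := Y)
  have hmem : w' ∈ farther G v' w := by
    refine ⟨hww', ?_⟩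
    have h1 := dist_le_succ_of_adj hc v' hww'
    have h2 := dist_le_succ_of_adj hc w' hv'.1.symm
    omega
  rw [← farther_eq_of_between hG (x := Y) (x' := v') (y := w) (by omega)
    (by rw [hYw, hbb]; congr 1; omega)] at hmem
  exact hw'n hmem

end Zone

/-- The intersection numbers of a distance-regular graph with `c₂ ≥ 2` are not constant between
`i` and `3i`. -/
theorem not_constant_of_two_le_c_two (hG : IsDistanceRegularWith G b c) (h2 : 2 ≤ c 2) {i : ℕ}
    (hi : 1 ≤ i) (hN : ∃ x y, G.dist x y = 3 * i) : ¬ (c i = c (3 * i) ∧ b i = b (3 * i)) := by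
  have hc := hG.1
  induction i, hi using Nat.le_induction with
  | base =>
    rintro ⟨h, -⟩
    have h3 := hG.c_mono hN (i := 2) (j := 3) (by omega) (by omega)
    obtain ⟨x, y, hxy⟩ := exists_dist_eq_of_le hc hN (n := 1) (by omega)
    have hone : (nearer G x y).ncard ≤ 1 := by
      rw [Set.ncard_le_one_iff (Set.toFinite _)]
      rintro p q ⟨-, hp⟩ ⟨-, hq⟩
      have h1 := hc.dist_eq_zero_iff.1 (show G.dist x p = 0 by omega)
      have h2 := hc.dist_eq_zero_iff.1 (show G.dist x q = 0 by omega)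
      rw [← h1, ← h2]
    rw [hG.ncard_nearer, hxy] at hone
    norm_num at h
    omega
  | succ i hi ih =>
    rintro ⟨h, h'⟩
    have hcc : ∀ j, i + 1 ≤ j → j ≤ 3 * (i + 1) → c j = c (i + 1) := fun j h1 h2 =>
      le_antisymm (h ▸ hG.c_mono hN h2 le_rfl) (hG.c_mono hN h1 h2)
    have hbb : ∀ j, i + 1 ≤ j → j ≤ 3 * (i + 1) → b j = b (i + 1) := fun j h1 h2 =>
      le_antisymm (hG.b_anti hN h1 h2) (h' ▸ hG.b_anti hN h2 le_rfl)
    have hN1 := exists_dist_eq_of_le hc hN (n := 2 * (i + 1) - 1) (by omega)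
    have hb := b_pred_eq_of_constant hG (i := i + 1) (by omega) hN1
      (fun j h1 h2 => hcc j h1 (by omega)) (fun j h1 h2 => hbb j h1 (by omega))
    have hcp := c_pred_eq_of_constant hG (i := i + 1) (by omega) hN1
      (fun j h1 h2 => hcc j h1 (by omega)) (by rw [hb]; exact hbb _ (by omega) (by omega))
    simp only [Nat.add_sub_cancel] at hb hcp
    refine ih (exists_dist_eq_of_le hc hN (by omega)) ⟨?_, ?_⟩
    · rw [hcp]; exact (hcc _ (by omega) (by omega)).symm
    · rw [hb]; exact (hbb _ (by omega) (by omega)).symm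

/-- The valency bounds the diameter of a distance-regular graph with `c₂ ≥ 2`. -/
theorem dist_lt_of_two_le_c_two (hG : IsDistanceRegularWith G b c) (h2 : 2 ≤ c 2) (x y : V) :
    G.dist x y < 3 ^ (2 * b 0 + 1) := by
  have hc := hG.1
  by_contra hcon
  push Not at hcon
  have hN : ∃ x y, G.dist x y = 3 ^ (2 * b 0 + 1) := exists_dist_eq_of_le hc ⟨x, y, rfl⟩ hcon
  -- `c - b` starts at no less than `-b 0` and gains at least one with each tripling, yet never
  -- exceeds `b 0`; hence the exponent `2 * b 0 + 1`.
  have grow : ∀ n, n ≤ 2 * b 0 + 1 → n + b (3 ^ n) ≤ c (3 ^ n) + b 0 := by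
    intro n
    induction n with
    | zero =>
      intro _
      have := hG.b_anti hN (i := 0) (j := 3 ^ 0) (by omega)
        (Nat.pow_le_pow_right (by omega) (by omega))
      omega
    | succ n ih =>
      intro hn
      have hle : 3 ^ (n + 1) ≤ 3 ^ (2 * b 0 + 1) := Nat.pow_le_pow_right (by omega) hn
      have hle' : 3 ^ n ≤ 3 ^ (n + 1) := Nat.pow_le_pow_right (by omega) (by omega)
      have h1 := hG.c_mono hN hle' hle
      have h2' := hG.b_anti hN hle' hle
      have h3 := not_constant_of_two_le_c_two hG h2 (i := 3 ^ n) (Nat.one_le_pow _ _ (by omega))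
        (exists_dist_eq_of_le hc hN (by rw [← pow_succ']; exact hle))
      rw [← pow_succ'] at h3
      have := ih (by omega)
      omega
  have := grow _ le_rfl
  obtain ⟨p, q, hpq⟩ := hN
  have hle : c (3 ^ (2 * b 0 + 1)) ≤ b 0 := by
    have hsub : nearer G p q ⊆ farther G q q := by
      rintro z ⟨hz, -⟩
      exact ⟨hz, by rw [SimpleGraph.dist_self, SimpleGraph.dist_eq_one_iff_adj.2 hz]⟩
    have h0 := Set.ncard_le_ncard hsub (Set.toFinite _)
    rwa [hG.ncard_nearer, hG.ncard_farther, hpq, SimpleGraph.dist_self] at h0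
  omega

/-- A graph of valency `k` and diameter less than `d` has at most `(k + 1) ^ d` vertices. -/
theorem card_le_of_dist_lt (hG : IsDistanceRegularWith G b c) {d : ℕ}
    (hd : ∀ x y, G.dist x y < d) : Nat.card V ≤ (b 0 + 1) ^ d := by
  classical
  have := Fintype.ofFinite V
  have hc := hG.1
  obtain ⟨x⟩ := hc.nonempty
  have hdeg : ∀ y, (Finset.univ.filter fun z => G.Adj y z).card = b 0 := by
    intro y
    have h0 := hG.ncard_farther y y
    rw [SimpleGraph.dist_self] at h0
    rw [← h0, ← Set.ncard_coe_finset]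
    congr 1
    ext z
    simp only [Finset.coe_filter, Finset.mem_univ, true_and, Set.mem_ofPred_eq, farther,
      SimpleGraph.dist_self, zero_add, SimpleGraph.dist_eq_one_iff_adj, and_self]
  have ball : ∀ n, (Finset.univ.filter fun z => G.dist x z ≤ n).card ≤ (b 0 + 1) ^ n := by
    intro n
    induction n with
    | zero =>
      rw [pow_zero, Finset.card_le_one]
      intro p hp q hq
      simp only [Finset.mem_filter, Finset.mem_univ, true_and, Nat.le_zero,
        hc.dist_eq_zero_iff] at hp hq
      rw [← hp, ← hq]
    | succ n ih =>
      have hsub : (Finset.univ.filter fun z => G.dist x z ≤ n + 1) ⊆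
          (Finset.univ.filter fun z => G.dist x z ≤ n).biUnion
            fun y => insert y (Finset.univ.filter fun z => G.Adj y z) := by
        intro z hz
        simp only [Finset.mem_filter, Finset.mem_univ, true_and] at hz
        simp only [Finset.mem_biUnion, Finset.mem_filter, Finset.mem_univ, true_and,
          Finset.mem_insert]
        by_cases h : G.dist x z ≤ n
        · exact ⟨z, h, Or.inl rfl⟩
        · obtain ⟨y, hy, hyd⟩ := exists_mem_nearer hc (x := x) (y := z) (by omega)
          exact ⟨y, by omega, Or.inr hy.symm⟩
      calc _ ≤ _ := Finset.card_le_card hsub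
        _ ≤ _ := Finset.card_biUnion_le_card_mul _ _ (b 0 + 1) fun y _ =>
            (Finset.card_insert_le _ _).trans (by rw [hdeg])
        _ ≤ _ := by rw [pow_succ]; exact Nat.mul_le_mul_right _ ih
  have := ball d
  rwa [Finset.filter_true_of_mem fun z _ => (hd x z).le, Finset.card_univ,
    ← Nat.card_eq_fintype_card] at this

end DiameterBound

/-! ### Graphs in which nonadjacent vertices have clique common neighbourhoods of fixed size. -/

open Finset

/-- `L` is a clique to which no vertex can be added. -/
def IsMaximalClique {W : Type*} (Δ : SimpleGraph W) (L : Finset W) : Prop :=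
  Δ.IsClique (L : Set W) ∧ ∀ w, (∀ z ∈ L, w = z ∨ Δ.Adj w z) → w ∈ L

theorem exists_isMaximalClique {W : Type*} [Finite W] {Δ : SimpleGraph W} {K : Finset W}
    (hK : Δ.IsClique (K : Set W)) : ∃ L, K ⊆ L ∧ IsMaximalClique Δ L := by
  classical
  have := Fintype.ofFinite W
  obtain ⟨L, hL, hmax⟩ := Finset.exists_max_image
    (univ.filter fun L : Finset W => K ⊆ L ∧ Δ.IsClique (L : Set W)) Finset.card
    ⟨K, by simpa using hK⟩
  simp only [mem_filter, mem_univ, true_and] at hL hmax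
  refine ⟨L, hL.1, hL.2, fun w hw => ?_⟩
  by_contra hwL
  have := hmax (insert w L) ⟨hL.1.trans (subset_insert _ _), by
    rw [coe_insert]
    exact hL.2.insert fun z hz hne => (hw z hz).resolve_left hne⟩
  rw [card_insert_of_notMem hwL] at this
  omega

section CliqueCommonNeighbors

variable {W : Type*} [Fintype W] [DecidableEq W] {Δ : SimpleGraph W} [DecidableRel Δ.Adj]

/-- Any two distinct nonadjacent vertices have exactly `μ` common neighbours, forming a clique. -/
structure HasCliqueCommonNeighbors (Δ : SimpleGraph W) [DecidableRel Δ.Adj] (μ : ℕ) : Prop where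
  adj : ∀ {y z p q : W}, y ≠ z → ¬ Δ.Adj y z → Δ.Adj y p → Δ.Adj z p → Δ.Adj y q → Δ.Adj z q →
    p ≠ q → Δ.Adj p q
  card : ∀ {y z : W}, y ≠ z → ¬ Δ.Adj y z →
    (Δ.neighborFinset y ∩ Δ.neighborFinset z).card = μ

/-- `S` is covered by at most `n` cliques. -/
def CoveredByCliques (Δ : SimpleGraph W) (S : Finset W) (n : ℕ) : Prop :=
  ∃ 𝒦 : Finset (Finset W), 𝒦.card ≤ n ∧ (∀ K ∈ 𝒦, Δ.IsClique (K : Set W)) ∧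
    ∀ v ∈ S, ∃ K ∈ 𝒦, v ∈ K

variable {μ : ℕ}

/-- Take a maximum independent subset `I` of `S`. A vertex seeing two members of `I` lies in their
common neighbourhood, which is a clique. The vertices whose only neighbour in `I` is `i`, together
with `i`, form a clique, since two nonadjacent ones could replace `i`. Pairs `(i, j)` and `(i, i)`
index these cliques. -/
theorem HasCliqueCommonNeighbors.coveredByCliques (hΔ : HasCliqueCommonNeighbors Δ μ)
    {S : Finset W} {n : ℕ}
    (hS : ∀ I ⊆ S, (∀ u ∈ I, ∀ v ∈ I, ¬ Δ.Adj u v) → I.card ≤ n) :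
    CoveredByCliques Δ S (n ^ 2) := by
  classical
  obtain ⟨I, hI, hmax⟩ := Finset.exists_max_image
    (S.powerset.filter fun I => ∀ u ∈ I, ∀ v ∈ I, ¬ Δ.Adj u v) Finset.card
    ⟨∅, by simp⟩
  simp only [mem_filter, mem_powerset] at hI hmax
  obtain ⟨hIS, hind⟩ := hI
  let P : W → Finset W := fun i =>
    S.filter fun v => (v = i ∨ Δ.Adj i v) ∧ ∀ j ∈ I, j ≠ i → ¬ Δ.Adj j v
  let K : W × W → Finset W := fun ij =>
    if ij.1 = ij.2 then P ij.1 else Δ.neighborFinset ij.1 ∩ Δ.neighborFinset ij.2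
  refine ⟨(I ×ˢ I).image K, ?_, ?_, ?_⟩
  · refine card_image_le.trans ?_
    rw [card_product, ← sq]
    exact Nat.pow_le_pow_left (hS I hIS hind) 2
  · intro L hL
    simp only [mem_image, mem_product, Prod.exists] at hL
    obtain ⟨i, j, ⟨hi, hj⟩, rfl⟩ := hL
    by_cases hij : i = j
    · subst hij
      intro v hv v' hv' hne
      simp only [K, P, if_true, coe_filter] at hv hv'
      obtain ⟨hvS, hv1, hv2⟩ := hv
      obtain ⟨hvS', hv1', hv2'⟩ := hv'
      by_contra hnadj
      rcases hv1 with rfl | hv1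
      · rcases hv1' with rfl | hv1'
        · exact hne rfl
        · exact hnadj hv1'
      rcases hv1' with rfl | hv1'
      · exact hnadj hv1.symm
      have hvI : v ∉ I := fun h => hind i hi v h hv1
      have hvI' : v' ∉ I := fun h => hind i hi v' h hv1'
      have h1 := hmax (insert v (insert v' (I.erase i))) ⟨by
          intro x hx
          simp only [mem_insert, mem_erase] at hx
          rcases hx with rfl | rfl | hx
          · exact hvS
          · exact hvS'
          · exact hIS hx.2, by
          have hn' : ¬ Δ.Adj v' v := fun h => hnadj h.symm
          intro x hx y hy
          simp only [mem_insert, mem_erase] at hx hy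
          rcases hx with rfl | rfl | hx <;> rcases hy with rfl | rfl | hy
          · exact Δ.loopless.irrefl _
          · exact hnadj
          · exact fun h => hv2 y hy.2 hy.1 h.symm
          · exact hn'
          · exact Δ.loopless.irrefl _
          · exact fun h => hv2' y hy.2 hy.1 h.symm
          · exact hv2 x hx.2 hx.1
          · exact hv2' x hx.2 hx.1
          · exact hind x hx.2 y hy.2⟩
      rw [card_insert_of_notMem (by simp [hne, hvI]), card_insert_of_notMem (by simp [hvI']),
        card_erase_of_mem hi] at h1
      have := card_pos.2 ⟨i, hi⟩
      omega
    · intro v hv v' hv' hne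
      simp only [K, hij, if_false, coe_inter, SimpleGraph.coe_neighborFinset] at hv hv'
      exact hΔ.adj hij (hind i hi j hj) hv.1 hv.2 hv'.1 hv'.2 hne
  · intro v hv
    by_cases hvI : v ∈ I
    · refine ⟨K (v, v), mem_image_of_mem _ (mem_product.2 ⟨hvI, hvI⟩), ?_⟩
      simp only [K, P, if_true, mem_filter]
      exact ⟨hv, Or.inl trivial, fun j hj _ => hind j hj v hvI⟩
    · obtain ⟨i, hi, hiv⟩ : ∃ i ∈ I, Δ.Adj i v := by
        by_contra hcon
        push Not at hcon
        have h1 := hmax (insert v I) ⟨by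
          intro x hx
          rcases mem_insert.1 hx with rfl | hx
          · exact hv
          · exact hIS hx, by
          intro x hx y hy
          rcases mem_insert.1 hx with rfl | hx' <;> rcases mem_insert.1 hy with rfl | hy'
          · exact Δ.loopless.irrefl _
          · exact fun h => hcon y hy' h.symm
          · exact hcon x hx'
          · exact hind x hx' y hy'⟩
        rw [card_insert_of_notMem hvI] at h1
        omega
      by_cases hj : ∃ j ∈ I, j ≠ i ∧ Δ.Adj j v
      · obtain ⟨j, hj, hji, hjv⟩ := hj
        refine ⟨K (i, j), mem_image_of_mem _ (mem_product.2 ⟨hi, hj⟩), ?_⟩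
        simp [K, Ne.symm hji, hiv, hjv]
      · push Not at hj
        refine ⟨K (i, i), mem_image_of_mem _ (mem_product.2 ⟨hi, hi⟩), ?_⟩
        simp only [K, P, if_true, mem_filter]
        exact ⟨hv, Or.inr hiv, hj⟩

/-- The neighbourhoods of two adjacent vertices in a clique avoiding them are nested. -/
theorem HasCliqueCommonNeighbors.nested (hΔ : HasCliqueCommonNeighbors Δ μ) {L : Finset W}
    (hL : Δ.IsClique (L : Set W)) {p p' : W} (hp : p ∉ L) (hp' : p' ∉ L) (h : p = p' ∨ Δ.Adj p p')
    (hcard : (Δ.neighborFinset p ∩ L).card ≤ (Δ.neighborFinset p' ∩ L).card) :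
    Δ.neighborFinset p ∩ L ⊆ Δ.neighborFinset p' ∩ L := by
  rcases h with rfl | h
  · exact Subset.rfl
  by_contra hsub
  obtain ⟨z, hz, hzn⟩ := not_subset.1 hsub
  obtain ⟨z', hz', hzn'⟩ : ∃ z' ∈ Δ.neighborFinset p' ∩ L, z' ∉ Δ.neighborFinset p ∩ L := by
    by_contra hcon
    push Not at hcon
    exact hsub (eq_of_subset_of_card_le hcon hcard).symm.subset
  simp only [mem_inter, SimpleGraph.mem_neighborFinset, not_and] at hz hz' hzn hzn'
  have h1 : ¬ Δ.Adj p' z := fun h => hzn h hz.2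
  have h2 : ¬ Δ.Adj p z' := fun h => hzn' h hz'.2
  have hne : z' ≠ z := fun e => h1 (e ▸ hz'.1)
  -- `p` and `z'` are common neighbours of the nonadjacent pair `p'`, `z`: an induced 4-cycle is
  -- impossible.
  exact h2 (hΔ.adj (y := p') (z := z) (fun e => hp' (e ▸ hz.2)) h1 h.symm hz.1.symm hz'.1
    (hL hz.2 hz'.2 hne.symm) (fun e => hp (e ▸ hz'.2)))

/-- Among pairwise adjacent vertices outside a clique, some have the smallest neighbourhood in
it. -/
theorem HasCliqueCommonNeighbors.exists_least (hΔ : HasCliqueCommonNeighbors Δ μ) {K L : Finset W}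
    (hK : Δ.IsClique (K : Set W)) (hL : Δ.IsClique (L : Set W)) (hKL : Disjoint K L)
    (hne : K.Nonempty) :
    ∃ p ∈ K, ∀ q ∈ K, Δ.neighborFinset p ∩ L ⊆ Δ.neighborFinset q ∩ L := by
  obtain ⟨p, hp, hmin⟩ := exists_min_image K (fun p => (Δ.neighborFinset p ∩ L).card) hne
  refine ⟨p, hp, fun q hq => hΔ.nested hL (disjoint_left.1 hKL hp) (disjoint_left.1 hKL hq) ?_
    (hmin q hq)⟩
  by_cases h : p = q
  · exact Or.inl h
  · exact Or.inr (hK hp hq h)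

/-- Among pairwise adjacent vertices outside a clique, some have the largest neighbourhood in it. -/
theorem HasCliqueCommonNeighbors.exists_greatest (hΔ : HasCliqueCommonNeighbors Δ μ)
    {K L : Finset W} (hK : Δ.IsClique (K : Set W)) (hL : Δ.IsClique (L : Set W))
    (hKL : Disjoint K L) (hne : K.Nonempty) :
    ∃ p ∈ K, ∀ q ∈ K, Δ.neighborFinset q ∩ L ⊆ Δ.neighborFinset p ∩ L := by
  obtain ⟨p, hp, hmax⟩ := exists_max_image K (fun p => (Δ.neighborFinset p ∩ L).card) hne
  refine ⟨p, hp, fun q hq => hΔ.nested hL (disjoint_left.1 hKL hq) (disjoint_left.1 hKL hp) ?_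
    (hmax q hq)⟩
  by_cases h : q = p
  · exact Or.inl h
  · exact Or.inr (hK hq hp h)

/-- By maximality `w` has a non-neighbour `z` in `L`, and all neighbours of `w` in `L` are common
neighbours of `w` and `z`. -/
theorem HasCliqueCommonNeighbors.card_inter_le (hΔ : HasCliqueCommonNeighbors Δ μ) {L : Finset W}
    (hL : IsMaximalClique Δ L) {w : W} (hw : w ∉ L) : (Δ.neighborFinset w ∩ L).card ≤ μ := by
  obtain ⟨z, hz, hne, hzw⟩ : ∃ z ∈ L, w ≠ z ∧ ¬ Δ.Adj w z := by
    by_contra hcon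
    push Not at hcon
    exact hw (hL.2 w fun z hz => or_iff_not_imp_left.2 (hcon z hz))
  rw [← hΔ.card hne hzw]
  refine card_le_card fun p hp => ?_
  simp only [mem_inter, SimpleGraph.mem_neighborFinset] at hp ⊢
  exact ⟨hp.1, hL.1 hz hp.2 fun e => hzw (e ▸ hp.1)⟩

/-- A vertex outside a large maximal clique has exactly `μ` neighbours in it. -/
theorem HasCliqueCommonNeighbors.card_inter_eq (hΔ : HasCliqueCommonNeighbors Δ μ) {n : ℕ}
    (hcov : ∀ w, CoveredByCliques Δ (Δ.neighborFinset w) n) {L : Finset W}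
    (hL : IsMaximalClique Δ L) (hbig : (n + 1) * μ < L.card) {w : W} (hw : w ∉ L) :
    (Δ.neighborFinset w ∩ L).card = μ := by
  refine le_antisymm (hΔ.card_inter_le hL hw) ?_
  by_contra hlt
  push Not at hlt
  obtain ⟨𝒦, h𝒦, hcl, hc⟩ := hcov w
  -- With fewer than `μ` neighbours of `w` in `L`, each non-neighbour `z ∈ L` shares with `w` a
  -- neighbour outside `L`. Within one clique of the cover the traces on `L` are nested, so their
  -- union has size at most `μ`; altogether `L` has at most `(n + 1) * μ` elements.
  have hsub : L ⊆ (Δ.neighborFinset w ∩ L) ∪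
      𝒦.biUnion fun K => (K \ L).biUnion fun p => Δ.neighborFinset p ∩ L := by
    intro z hz
    by_cases hwz : Δ.Adj w z
    · exact mem_union_left _ (by simp [hwz, hz])
    have hne : w ≠ z := fun e => hw (e ▸ hz)
    obtain ⟨p, hp, hpL⟩ : ∃ p ∈ Δ.neighborFinset w ∩ Δ.neighborFinset z, p ∉ L := by
      by_contra hcon
      push Not at hcon
      have := card_le_card (s := Δ.neighborFinset w ∩ Δ.neighborFinset z)
        (t := Δ.neighborFinset w ∩ L) fun p hp =>
          mem_inter.2 ⟨(mem_inter.1 hp).1, hcon p hp⟩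
      rw [hΔ.card hne hwz] at this
      omega
    obtain ⟨hp1, hp2⟩ := mem_inter.1 hp
    obtain ⟨K, hK, hpK⟩ := hc p hp1
    refine mem_union_right _ (mem_biUnion.2 ⟨K, hK, mem_biUnion.2 ⟨p, mem_sdiff.2 ⟨hpK, hpL⟩, ?_⟩⟩)
    rw [SimpleGraph.mem_neighborFinset] at hp2
    exact mem_inter.2 ⟨by rw [SimpleGraph.mem_neighborFinset]; exact hp2.symm, hz⟩
  have hK : ∀ K ∈ 𝒦, ((K \ L).biUnion fun p => Δ.neighborFinset p ∩ L).card ≤ μ := by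
    intro K hK
    rcases (K \ L).eq_empty_or_nonempty with h | h
    · simp [h]
    obtain ⟨p, hp, hmax⟩ := hΔ.exists_greatest (K := K \ L) ((hcl K hK).subset (by simp)) hL.1
      sdiff_disjoint h
    exact (card_le_card (biUnion_subset.2 hmax)).trans
      (hΔ.card_inter_le hL (mem_sdiff.1 hp).2)
  have h1 := card_le_card hsub
  have h2 := card_union_le (Δ.neighborFinset w ∩ L)
    (𝒦.biUnion fun K => (K \ L).biUnion fun p => Δ.neighborFinset p ∩ L)
  have h3 := card_biUnion_le_card_mul 𝒦 _ μ hK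
  have h4 := Nat.mul_le_mul_right μ h𝒦
  have h5 : (n + 1) * μ = n * μ + μ := by ring
  omega

/-- In a regular non-complete graph with the common neighbour property whose local graphs are
covered by `n` cliques, the degree is at most `n (n + 1) μ`. -/
theorem HasCliqueCommonNeighbors.degree_le (hΔ : HasCliqueCommonNeighbors Δ μ) (hμ : 1 ≤ μ)
    {n a : ℕ} (hcov : ∀ w, CoveredByCliques Δ (Δ.neighborFinset w) n)
    (hreg : ∀ v, (Δ.neighborFinset v).card = a) {y z : W} (hyz : y ≠ z) (hnadj : ¬ Δ.Adj y z) :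
    a ≤ n * ((n + 1) * μ) := by
  by_contra hlt
  push Not at hlt
  have hbig : ∀ v, ∃ L, v ∈ L ∧ IsMaximalClique Δ L ∧ (n + 1) * μ < L.card := by
    intro v
    obtain ⟨𝒦, h𝒦, hcl, hc⟩ := hcov v
    obtain ⟨K, hK, hKc⟩ : ∃ K ∈ 𝒦, (n + 1) * μ < (K ∩ Δ.neighborFinset v).card := by
      by_contra hcon
      push Not at hcon
      have h1 := card_biUnion_le_card_mul 𝒦 (fun K => K ∩ Δ.neighborFinset v) _ hcon
      have h2 : Δ.neighborFinset v ⊆ 𝒦.biUnion fun K => K ∩ Δ.neighborFinset v := fun p hp => by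
        obtain ⟨K, hK, hpK⟩ := hc p hp
        exact mem_biUnion.2 ⟨K, hK, mem_inter.2 ⟨hpK, hp⟩⟩
      have h3 := card_le_card h2
      have h4 := Nat.mul_le_mul_right ((n + 1) * μ) h𝒦
      rw [hreg] at h3
      omega
    obtain ⟨L, hKL, hL⟩ := exists_isMaximalClique (Δ := Δ)
      (K := insert v (K ∩ Δ.neighborFinset v)) (by
        rw [coe_insert]
        refine ((hcl K hK).subset (by simp)).insert fun p hp _ => ?_
        simpa using (mem_inter.1 (mem_coe.1 hp)).2)
    exact ⟨L, hKL (mem_insert_self _ _), hL,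
      hKc.trans_le (card_le_card ((subset_insert _ _).trans hKL))⟩
  obtain ⟨L, hyL, hL, hLc⟩ := hbig y
  obtain ⟨L₂, hzL₂, hL₂, hLc₂⟩ := hbig z
  have hzL : z ∉ L := fun h => hnadj (hL.1 hyL h hyz)
  have hcard := fun {w} => hΔ.card_inter_eq hcov hL hLc (w := w)
  have hcard₂ := fun {w} => hΔ.card_inter_eq hcov hL₂ hLc₂ (w := w)
  -- Nested traces of equal size `μ` coincide, so all of `L₂ \ L` sees the same vertices of `L`; by
  -- maximality these belong to `L₂` as well.
  have hconst : ∀ p ∈ L₂, p ∉ L → Δ.neighborFinset z ∩ L ⊆ Δ.neighborFinset p ∩ L := by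
    intro p hp hpL
    refine hΔ.nested hL.1 hzL hpL ?_ (by rw [hcard hzL, hcard hpL])
    by_cases h : z = p
    · exact Or.inl h
    · exact Or.inr (hL₂.1 hzL₂ hp h)
  have hQ : ∀ q ∈ Δ.neighborFinset z ∩ L, q ∈ L₂ := by
    intro q hq
    refine hL₂.2 q fun p hp => ?_
    by_cases hpL : p ∈ L
    · by_cases h : q = p
      · exact Or.inl h
      · exact Or.inr (hL.1 (mem_inter.1 hq).2 hpL h)
    · have := (mem_inter.1 (hconst p hp hpL hq)).1
      rw [SimpleGraph.mem_neighborFinset] at this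
      exact Or.inr this.symm
  obtain ⟨q, hq⟩ : (Δ.neighborFinset z ∩ L).Nonempty := by
    rw [← card_pos, hcard hzL]; exact hμ
  have hqL := (mem_inter.1 hq).2
  have hqL₂ := hQ q hq
  -- For `v` not adjacent to `q`, the `μ` common neighbours would be exactly the trace of `v` on `L`
  -- and also on `L₂`. They would lie in the `μ`-set `Δ.neighborFinset z ∩ L` while missing its
  -- element `q`. A vertex adjacent to all others makes a regular graph complete.
  have huniv : ∀ v, v ≠ q → Δ.Adj q v := by
    intro v hvq
    by_contra hn
    have hn' : ¬ Δ.Adj v q := fun h => hn h.symm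
    have hvL : v ∉ L := fun h => hn' (hL.1 h hqL hvq)
    have hvL₂ : v ∉ L₂ := fun h => hn' (hL₂.1 h hqL₂ hvq)
    have e : ∀ {M : Finset W}, Δ.IsClique (M : Set W) → q ∈ M →
        (Δ.neighborFinset v ∩ M).card = μ →
        Δ.neighborFinset v ∩ M = Δ.neighborFinset v ∩ Δ.neighborFinset q := by
      intro M hM hqM hMc
      refine eq_of_subset_of_card_le (fun p hp => ?_) (by rw [hMc, hΔ.card hvq hn'])
      simp only [mem_inter, SimpleGraph.mem_neighborFinset] at hp ⊢
      exact ⟨hp.1, hM hqM hp.2 fun e => hn' (e ▸ hp.1)⟩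
    have e1 := e hL.1 hqL (hcard hvL)
    have e2 := e hL₂.1 hqL₂ (hcard₂ hvL₂)
    have hss : Δ.neighborFinset v ∩ Δ.neighborFinset q ⊂ Δ.neighborFinset z ∩ L := by
      refine ⟨fun p hp => ?_, fun h => ?_⟩
      · have hp1 := (mem_inter.1 (e1 ▸ hp)).2
        have hp2 := (mem_inter.1 (e2 ▸ hp)).2
        refine mem_inter.2 ⟨?_, hp1⟩
        rw [SimpleGraph.mem_neighborFinset]
        exact hL₂.1 hzL₂ hp2 fun e => hzL (e ▸ hp1)
      · have := (mem_inter.1 (h hq)).2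
        simp at this
    have := card_lt_card hss
    rw [hΔ.card hvq hn', hcard hzL] at this
    omega
  have h1 : (Δ.neighborFinset q) = univ.erase q := by
    ext v
    simp only [SimpleGraph.mem_neighborFinset, mem_erase, mem_univ, and_true]
    exact ⟨fun h => h.ne.symm, huniv v⟩
  have h2 : Δ.neighborFinset y ⊂ univ.erase y := by
    refine ⟨fun v hv => ?_, fun h => hnadj ?_⟩
    · rw [SimpleGraph.mem_neighborFinset] at hv
      simpa using hv.ne.symm
    · simpa using h (mem_erase.2 ⟨hyz.symm, mem_univ z⟩)
  have h3 := card_lt_card h2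
  rw [hreg, ← hreg q, h1, card_erase_of_mem (mem_univ _), card_erase_of_mem (mem_univ _)] at h3
  omega

end CliqueCommonNeighbors

/-! ### Bounding the number of vertices by a lower bound on the eigenvalues. -/

theorem sum_indicator_eq_card_inter {W : Type*} [DecidableEq W] (A B : Finset W) :
    ∑ w ∈ A, (if w ∈ B then (1 : ℝ) else 0) = (A ∩ B).card := by
  rw [sum_boole, filter_mem_eq_inter]

section ValencyBound

variable {W : Type*} [Fintype W] [DecidableEq W] {Δ : SimpleGraph W} [DecidableRel Δ.Adj]

/-- The quadratic form of the adjacency matrix. -/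
def adjForm (Δ : SimpleGraph W) [DecidableRel Δ.Adj] (f : W → ℝ) : ℝ :=
  ∑ v, f v * ∑ w ∈ Δ.neighborFinset v, f w

/-- If no eigenvalue is less than `-m`, there are no large claws. -/
theorem card_le_sq_of_independent {m : ℕ} (hm : 1 ≤ m)
    (hform : ∀ f : W → ℝ, -(m : ℝ) * ∑ v, f v ^ 2 ≤ adjForm Δ f) {y : W} {I : Finset W}
    (hI : I ⊆ Δ.neighborFinset y) (hind : ∀ u ∈ I, ∀ v ∈ I, ¬ Δ.Adj u v) : I.card ≤ m ^ 2 := by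
  have hyI : y ∉ I := fun h => by simpa using hI h
  -- On `m · 1_y - 1_I` the form equals `-2m|I|` and the squared norm is `m² + |I|`, whence `|I| ≤
  -- m²`.
  have h := hform fun v => m * (if v ∈ ({y} : Finset W) then 1 else 0) - (if v ∈ I then 1 else 0)
  have hsq : ∀ v, ((m : ℝ) * (if v ∈ ({y} : Finset W) then 1 else 0) - (if v ∈ I then 1 else 0)) ^ 2
      = m ^ 2 * (if v ∈ ({y} : Finset W) then 1 else 0) + (if v ∈ I then 1 else 0) := by
    intro v
    by_cases h1 : v ∈ ({y} : Finset W)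
    · have : v ∉ I := by rw [mem_singleton.1 h1]; exact hyI
      simp [h1, this]
    · by_cases h2 : v ∈ I <;> simp [h1, h2]
  have hy : ∑ v ∈ I, (((Δ.neighborFinset v ∩ {y}).card : ℝ) * m - (Δ.neighborFinset v ∩ I).card)
      = I.card * m := by
    rw [sum_congr rfl fun v hv => ?_, sum_const, nsmul_eq_mul]
    have e1 : Δ.neighborFinset v ∩ {y} = {y} := by
      refine inter_eq_right.2 (singleton_subset_iff.2 ?_)
      have := hI hv
      simp only [SimpleGraph.mem_neighborFinset] at this ⊢
      exact this.symm
    have e2 : Δ.neighborFinset v ∩ I = ∅ := by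
      refine disjoint_iff_inter_eq_empty.1 (disjoint_right.2 fun u hu => ?_)
      rw [SimpleGraph.mem_neighborFinset]
      exact hind v hv u hu
    rw [e1, e2]
    simp
  have hyy : Δ.neighborFinset y ∩ {y} = ∅ := by
    simp
  simp only [hsq, adjForm, sum_sub_distrib, ← mul_sum, sum_indicator_eq_card_inter, sum_add_distrib,
    univ_inter, card_singleton, sub_mul] at h
  simp only [mul_ite, mul_one, mul_zero, ite_mul, zero_mul, one_mul, mem_singleton,
    sum_ite_eq', mem_univ, if_true, sum_ite_mem, univ_inter, hyy, inter_eq_right.2 hI] at h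
  rw [sum_sub_distrib] at hy
  rw [sum_sub_distrib] at h
  simp only [mul_comm (m : ℝ)] at h
  rw [hy] at h
  simp only [card_empty, Nat.cast_zero, zero_mul, zero_sub, Nat.cast_one] at h
  have hm' : (0 : ℝ) < m := by exact_mod_cast hm
  have : (I.card : ℝ) ≤ m ^ 2 := by
    by_contra hcon
    push Not at hcon
    nlinarith
  exact_mod_cast this

/-- If no eigenvalue is less than `-m`, two anticomplete cliques of size `n` cannot both be
completely joined to a third one if `n` is large. -/
theorem card_le_of_joined_cliques {m n : ℕ}
    (hform : ∀ f : W → ℝ, -(m : ℝ) * ∑ v, f v ^ 2 ≤ adjForm Δ f) {Y Z S : Finset W}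
    (hY : Δ.IsClique (Y : Set W)) (hZ : Δ.IsClique (Z : Set W)) (hS : Δ.IsClique (S : Set W))
    (hYZ : ∀ y ∈ Y, ∀ z ∈ Z, y ≠ z ∧ ¬ Δ.Adj y z) (hSY : ∀ s ∈ S, ∀ y ∈ Y, Δ.Adj s y)
    (hSZ : ∀ s ∈ S, ∀ z ∈ Z, Δ.Adj s z) (hYn : Y.card = n) (hZn : Z.card = n)
    (hSn : S.card = n) : n ≤ 3 * m := by
  have hdYZ : ∀ v ∈ Y, v ∉ Z := fun v hv hv' => (hYZ v hv v hv').1 rfl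
  have hdSY : ∀ v ∈ S, v ∉ Y := fun v hv hv' => (hSY v hv v hv').ne rfl
  have hdSZ : ∀ v ∈ S, v ∉ Z := fun v hv hv' => (hSZ v hv v hv').ne rfl
  have clique : ∀ {K : Finset W}, Δ.IsClique (K : Set W) → K.card = n → ∀ v ∈ K,
      ((Δ.neighborFinset v ∩ K).card : ℝ) = n - 1 := by
    intro K hK hKn v hv
    have : Δ.neighborFinset v ∩ K = K.erase v := by
      ext w
      simp only [mem_inter, SimpleGraph.mem_neighborFinset, mem_erase]
      exact ⟨fun h => ⟨h.1.ne.symm, h.2⟩, fun h => ⟨hK hv h.2 h.1.symm, h.2⟩⟩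
    rw [this, card_erase_of_mem hv, hKn, Nat.cast_sub, Nat.cast_one]
    exact hKn ▸ card_pos.2 ⟨v, hv⟩
  have full : ∀ {K : Finset W} {v : W}, K.card = n → (∀ w ∈ K, Δ.Adj v w) →
      ((Δ.neighborFinset v ∩ K).card : ℝ) = n := by
    intro K v hKn h
    rw [inter_eq_right.2 fun w hw => by simpa using h w hw, hKn]
  have none : ∀ {K : Finset W} {v : W}, (∀ w ∈ K, ¬ Δ.Adj v w) →
      ((Δ.neighborFinset v ∩ K).card : ℝ) = 0 := by
    intro K v h
    rw [disjoint_iff_inter_eq_empty.1 (disjoint_right.2 fun w hw => by simpa using h w hw)]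
    simp
  -- The least eigenvector of the three-clique configuration is proportional to `(1, 1, -√2)`; the
  -- integer weights `(2, 2, -3)` approximate it and give Rayleigh quotient `-(7n + 17) / 17`.
  set f : W → ℝ := fun v => 2 * (if v ∈ Y then 1 else 0) + 2 * (if v ∈ Z then 1 else 0)
    - 3 * (if v ∈ S then 1 else 0) with hf
  have h := hform f
  have hsq : ∑ v, f v ^ 2 = 17 * n := by
    have : ∀ v, f v ^ 2 = 4 * (if v ∈ Y then 1 else 0) + 4 * (if v ∈ Z then 1 else 0)
        + 9 * (if v ∈ S then 1 else 0) := by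
      intro v
      by_cases h1 : v ∈ Y
      · have h2 := hdYZ v h1
        have h3 : v ∉ S := fun h => hdSY v h h1
        simp only [hf, h1, h2, h3, if_true, if_false]; norm_num
      · by_cases h2 : v ∈ Z
        · have h3 : v ∉ S := fun h => hdSZ v h h2
          simp only [hf, h1, h2, h3, if_true, if_false]; norm_num
        · by_cases h3 : v ∈ S <;> simp only [hf, h1, h2, h3, if_true, if_false] <;> norm_num
    simp only [this, sum_add_distrib, ← mul_sum, sum_indicator_eq_card_inter, univ_inter, hYn, hZn,
      hSn]
    ring
  have hlin : adjForm Δ f = 2 * ∑ v ∈ Y, (∑ w ∈ Δ.neighborFinset v, f w)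
      + 2 * ∑ v ∈ Z, (∑ w ∈ Δ.neighborFinset v, f w)
      - 3 * ∑ v ∈ S, (∑ w ∈ Δ.neighborFinset v, f w) := by
    have e : ∀ g : W → ℝ, ∑ v, f v * g v = 2 * ∑ v ∈ Y, g v + 2 * ∑ v ∈ Z, g v
        - 3 * ∑ v ∈ S, g v := fun g => by
      have : ∀ (A : Finset W), ∑ v ∈ A, g v = ∑ v, (if v ∈ A then 1 else 0) * g v := fun A => by
        simp [sum_ite_mem]
      rw [this, this, this, mul_sum, mul_sum, mul_sum, ← sum_add_distrib, ← sum_sub_distrib]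
      exact sum_congr rfl fun v _ => by simp only [hf]; ring
    exact e _
  have hin : ∀ v, ∑ w ∈ Δ.neighborFinset v, f w = 2 * ((Δ.neighborFinset v ∩ Y).card : ℝ)
      + 2 * (Δ.neighborFinset v ∩ Z).card - 3 * (Δ.neighborFinset v ∩ S).card := fun v => by
    simp only [hf, sum_sub_distrib, sum_add_distrib, ← mul_sum, sum_indicator_eq_card_inter]
  have sY : ∑ v ∈ Y, (∑ w ∈ Δ.neighborFinset v, f w) = n * (-n - 2) := by
    rw [← hYn, ← nsmul_eq_mul, ← sum_const, hYn]
    refine sum_congr rfl fun v hv => ?_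
    rw [hin, clique hY hYn v hv, none fun w hw => (hYZ v hv w hw).2,
      full hSn fun s hs => (hSY s hs v hv).symm]
    ring
  have sZ : ∑ v ∈ Z, (∑ w ∈ Δ.neighborFinset v, f w) = n * (-n - 2) := by
    rw [← hZn, ← nsmul_eq_mul, ← sum_const, hZn]
    refine sum_congr rfl fun v hv => ?_
    rw [hin, clique hZ hZn v hv, none fun w hw h => (hYZ w hw v hv).2 h.symm,
      full hSn fun s hs => (hSZ s hs v hv).symm]
    ring
  have sS : ∑ v ∈ S, (∑ w ∈ Δ.neighborFinset v, f w) = n * (n + 3) := by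
    rw [← hSn, ← nsmul_eq_mul, ← sum_const, hSn]
    refine sum_congr rfl fun v hv => ?_
    rw [hin, clique hS hSn v hv, full hYn fun w hw => hSY v hv w hw,
      full hZn fun w hw => hSZ v hv w hw]
    ring
  rw [hsq, hlin, sY, sZ, sS] at h
  have : (n : ℝ) ≤ 3 * m := by
    by_contra hcon
    push Not at hcon
    have h0 : (0 : ℝ) ≤ m := Nat.cast_nonneg m
    nlinarith
  exact_mod_cast this

theorem sum_card_neighborFinset_inter (A B : Finset W) :
    ∑ x ∈ A, (Δ.neighborFinset x ∩ B).card = ∑ y ∈ B, (Δ.neighborFinset y ∩ A).card := by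
  have h := sum_card_bipartiteAbove_eq_sum_card_bipartiteBelow (s := A) (t := B) Δ.Adj
  convert h using 2
  · rename_i x _
    congr 1
    ext y
    simp [mem_bipartiteAbove, and_comm]
  · rename_i y _
    congr 1
    ext x
    simp [mem_bipartiteBelow, and_comm, Δ.adj_comm]

theorem card_compl_neighborFinset {a : ℕ} (hreg : ∀ v, (Δ.neighborFinset v).card = a) (v : W) :
    (Δᶜ.neighborFinset v).card = Fintype.card W - 1 - a := by
  rw [← hreg v]
  exact SimpleGraph.degree_compl Δ v

variable {μ : ℕ}

theorem card_independent_mul_le {a M : ℕ} (hreg : ∀ v, (Δ.neighborFinset v).card = a)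
    (hclaw : ∀ (y : W) (I : Finset W), I ⊆ Δ.neighborFinset y → (∀ u ∈ I, ∀ v ∈ I, ¬ Δ.Adj u v) →
      I.card ≤ M) {I : Finset W} (hind : ∀ u ∈ I, ∀ v ∈ I, ¬ Δ.Adj u v) :
    I.card * a ≤ M * Fintype.card W := by
  have h := sum_card_neighborFinset_inter (Δ := Δ) I univ
  simp only [inter_univ, hreg, sum_const, smul_eq_mul] at h
  rw [h, mul_comm M, ← smul_eq_mul, ← card_univ, ← sum_const]
  exact sum_le_sum fun v _ => hclaw v _ inter_subset_left fun u hu w hw =>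
    hind u (mem_inter.1 hu).2 w (mem_inter.1 hw).2

/-- Count the edges between the neighbours and the non-neighbours of `y` from both sides. -/
theorem HasCliqueCommonNeighbors.card_compl_mul_le (hΔ : HasCliqueCommonNeighbors Δ μ) {a : ℕ}
    (hreg : ∀ v, (Δ.neighborFinset v).card = a) (y : W) :
    (Δᶜ.neighborFinset y).card * μ ≤ a * a := by
  have h := sum_card_neighborFinset_inter (Δ := Δ) (Δ.neighborFinset y) (Δᶜ.neighborFinset y)
  have h1 : ∑ z ∈ Δᶜ.neighborFinset y, (Δ.neighborFinset z ∩ Δ.neighborFinset y).card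
      = (Δᶜ.neighborFinset y).card * μ := by
    rw [← smul_eq_mul, ← sum_const]
    refine sum_congr rfl fun z hz => ?_
    rw [SimpleGraph.mem_neighborFinset, SimpleGraph.compl_adj] at hz
    rw [inter_comm]
    exact hΔ.card hz.1 hz.2
  rw [← h1, ← h]
  conv_rhs => rw [← hreg y, ← smul_eq_mul, ← sum_const]
  exact sum_le_sum fun p _ => (card_le_card inter_subset_left).trans (by rw [hreg, hreg])

/-- Every vertex is nonadjacent to at least a quarter of the vertices. -/
theorem HasCliqueCommonNeighbors.card_le_four_mul (hΔ : HasCliqueCommonNeighbors Δ μ) {a : ℕ}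
    (hreg : ∀ v, (Δ.neighborFinset v).card = a) {y z : W} (hyz : y ≠ z) (hnadj : ¬ Δ.Adj y z) :
    Fintype.card W ≤ 4 * (Fintype.card W - 1 - a) := by
  set k := Fintype.card W with hk
  have hd := card_compl_neighborFinset hreg
  rw [← hk] at hd
  have hd1 : 1 ≤ k - 1 - a := by
    rw [← hd y]
    exact card_pos.2 ⟨z, by simp [hyz, hnadj]⟩
  set d := k - 1 - a with hdd
  set S := Δ.neighborFinset y ∩ Δ.neighborFinset z with hS
  have hSμ : S.card = μ := hΔ.card hyz hnadj
  have hSk : S.card ≤ k := card_le_univ S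
  have h1 : 2 * a + 2 ≤ k + μ := by
    have e := card_union_add_card_inter (Δ.neighborFinset y) (Δ.neighborFinset z)
    rw [hreg, hreg, ← hS, hSμ] at e
    have e2 : (Δ.neighborFinset y ∪ Δ.neighborFinset z).card ≤ ((univ.erase y).erase z).card := by
      refine card_le_card fun v hv => ?_
      simp only [mem_union, SimpleGraph.mem_neighborFinset] at hv
      simp only [mem_erase, mem_univ, and_true]
      constructor
      · rintro rfl
        exact hv.elim hnadj fun h => h.ne rfl
      · rintro rfl
        exact hv.elim (fun h => h.ne rfl) fun h => hnadj h.symm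
    rw [card_erase_of_mem (by simp [hyz.symm]), card_erase_of_mem (mem_univ _), card_univ,
      ← hk] at e2
    omega
  -- `S` is independent in the `d`-regular complement, so all `μ * d` complement edges leave it.
  -- This gives `2μ ≤ k`, which with `h1` yields `a + 1 ≤ 3k / 4`.
  have h2 : μ * d ≤ (k - μ) * d := by
    have e := sum_card_neighborFinset_inter (Δ := Δᶜ) S univ
    simp only [inter_univ, hd, sum_const, smul_eq_mul, hSμ] at e
    have e0 : ∑ v ∈ S, (Δᶜ.neighborFinset v ∩ S).card = 0 := by
      refine sum_eq_zero fun v hv => card_eq_zero.2 ?_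
      refine disjoint_iff_inter_eq_empty.1 (disjoint_right.2 fun u hu hvu => ?_)
      rw [SimpleGraph.mem_neighborFinset, SimpleGraph.compl_adj] at hvu
      simp only [hS, mem_inter, SimpleGraph.mem_neighborFinset] at hv hu
      exact hvu.2 (hΔ.adj hyz hnadj hv.1 hv.2 hu.1 hu.2 hvu.1)
    have e1 : ∑ v ∈ univ \ S, (Δᶜ.neighborFinset v ∩ S).card ≤ (k - μ) * d := by
      rw [← hSμ, hk, ← card_univ, ← card_sdiff_of_subset (subset_univ S), ← smul_eq_mul,
        ← sum_const]
      exact sum_le_sum fun v _ => (card_le_card inter_subset_left).trans (hd v).le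
    rw [e, ← sum_sdiff (subset_univ S), e0, add_zero]
    exact e1
  have h3 := Nat.le_of_mul_le_mul_right h2 hd1
  omega

/-- A graph with many nonadjacent pairs covered by few cliques has two large cliques with no edges
between them. -/
theorem HasCliqueCommonNeighbors.exists_anticomplete (hΔ : HasCliqueCommonNeighbors Δ μ) {n d : ℕ}
    (hcov : CoveredByCliques Δ univ n) (hd : ∀ v, (Δᶜ.neighborFinset v).card = d)
    (hk : Fintype.card W ≤ 4 * d) (hpos : 0 < Fintype.card W) :
    ∃ Y Z : Finset W, Δ.IsClique (Y : Set W) ∧ Δ.IsClique (Z : Set W) ∧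
      (∀ y ∈ Y, ∀ z ∈ Z, y ≠ z ∧ ¬ Δ.Adj y z) ∧
      Fintype.card W ≤ 8 * n ^ 2 * Y.card ∧ Fintype.card W ≤ 8 * n ^ 2 * Z.card := by
  set k := Fintype.card W with hkdef
  obtain ⟨𝒦, h𝒦, hcl, hc⟩ := hcov
  have hne : 𝒦.Nonempty := by
    obtain ⟨v⟩ := Fintype.card_pos_iff.1 hpos
    obtain ⟨K, hK, -⟩ := hc v (mem_univ v)
    exact ⟨K, hK⟩
  let e : Finset W × Finset W → Finset (Σ _ : W, W) := fun p =>
    p.1.sigma fun y => Δᶜ.neighborFinset y ∩ p.2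
  obtain ⟨⟨K, L⟩, hKL, hmax⟩ := exists_max_image (𝒦 ×ˢ 𝒦) (fun p => (e p).card)
    (hne.product hne)
  obtain ⟨hK, hL⟩ := mem_product.1 hKL
  replace hK := hcl _ hK
  replace hL := hcl _ hL
  have htot : k * d ≤ n ^ 2 * (e (K, L)).card := by
    have h1 : (univ.sigma fun y => Δᶜ.neighborFinset y).card = k * d := by
      rw [card_sigma]
      simp [hd, hkdef]
    have h2 : (univ.sigma fun y => Δᶜ.neighborFinset y) ⊆ (𝒦 ×ˢ 𝒦).biUnion e := by
      rintro ⟨y, z⟩ h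
      obtain ⟨K₁, hK₁, hy⟩ := hc y (mem_univ y)
      obtain ⟨K₂, hK₂, hz⟩ := hc z (mem_univ z)
      refine mem_biUnion.2 ⟨(K₁, K₂), mem_product.2 ⟨hK₁, hK₂⟩, ?_⟩
      exact mem_sigma.2 ⟨hy, mem_inter.2 ⟨(mem_sigma.1 h).2, hz⟩⟩
    rw [← h1]
    refine (card_le_card h2).trans ((card_biUnion_le_card_mul _ _ _ hmax).trans ?_)
    rw [card_product, ← sq]
    exact Nat.mul_le_mul_right _ (Nat.pow_le_pow_left h𝒦 2)
  have hn : 0 < 8 * n ^ 2 := by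
    have := card_pos.2 hne
    have : 0 < n := by omega
    positivity
  -- Some pair of cliques `(K, L)` carries at least `k² / (4n²)` nonadjacent pairs. The threshold is
  -- half the resulting average of non-neighbours in `L`, so many vertices of `K` exceed it.
  obtain ⟨t, ht1, ht2⟩ : ∃ t, 8 * n ^ 2 * t ≤ k ∧ k < 8 * n ^ 2 * (t + 1) := by
    refine ⟨k / (8 * n ^ 2), Nat.mul_div_le _ _, ?_⟩
    rw [mul_comm]
    exact Nat.lt_mul_of_div_lt (Nat.lt_succ_self _) hn
  set Y := K.filter fun y => t < (Δᶜ.neighborFinset y ∩ L).card with hY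
  have hYcard : k ≤ 8 * n ^ 2 * Y.card := by
    have h1 : (e (K, L)).card ≤ Y.card * k + k * t := by
      rw [card_sigma]
      calc ∑ y ∈ K, (Δᶜ.neighborFinset y ∩ L).card
          ≤ ∑ y ∈ K, ((if t < (Δᶜ.neighborFinset y ∩ L).card then k else 0) + t) := by
            refine sum_le_sum fun y _ => ?_
            have := card_le_univ (Δᶜ.neighborFinset y ∩ L)
            split_ifs <;> omega
        _ = Y.card * k + K.card * t := by
            rw [sum_add_distrib, ← sum_filter, sum_const, sum_const, smul_eq_mul, smul_eq_mul]
        _ ≤ _ := by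
            have : K.card * t ≤ k * t := Nat.mul_le_mul_right t (card_le_univ K)
            omega
    have h2 : k * k ≤ k * (4 * n ^ 2 * (Y.card + t)) := by
      calc k * k ≤ k * (4 * d) := Nat.mul_le_mul_left _ hk
        _ = 4 * (k * d) := by ring
        _ ≤ 4 * (n ^ 2 * (Y.card * k + k * t)) :=
            Nat.mul_le_mul_left _ (htot.trans (Nat.mul_le_mul_left _ h1))
        _ = _ := by ring
    have h3 := Nat.le_of_mul_le_mul_left h2 hpos
    nlinarith
  have hYcl : Δ.IsClique (Y : Set W) := hK.subset (coe_subset.2 (filter_subset _ _))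
  have hYL : Disjoint Y L := by
    refine disjoint_left.2 fun y hy hyL => ?_
    obtain ⟨v, hv⟩ := card_pos.1 (Nat.zero_lt_of_lt (mem_filter.1 hy).2)
    rw [mem_inter, SimpleGraph.mem_neighborFinset, SimpleGraph.compl_adj] at hv
    exact hv.1.2 (hL hyL hv.2 hv.1.1)
  have hYne : Y.Nonempty := by
    rw [← card_pos]
    by_contra h
    rw [Nat.eq_zero_of_not_pos h] at hYcard
    omega
  -- What the vertex with the greatest trace on `L` misses is missed by all of `Y`.
  obtain ⟨p, hp, hpmax⟩ := hΔ.exists_greatest hYcl hL hYL hYne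
  refine ⟨Y, Δᶜ.neighborFinset p ∩ L, hYcl, hL.subset (by simp), ?_, hYcard,
    ht2.le.trans (Nat.mul_le_mul_left _ (mem_filter.1 hp).2)⟩
  intro y hy z hz
  obtain ⟨hz1, hz2⟩ := mem_inter.1 hz
  rw [SimpleGraph.mem_neighborFinset, SimpleGraph.compl_adj] at hz1
  refine ⟨fun h => disjoint_left.1 hYL hy (h ▸ hz2), fun h => hz1.2 ?_⟩
  have := hpmax y hy (mem_inter.2 ⟨by simpa using h, hz2⟩)
  simpa using (mem_inter.1 this).1

/-- Both sides count triples `(s, y, z)` with `s` adjacent to `y` and to `z`. -/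
theorem sum_card_inter_mul_card_inter (Y Z : Finset W) :
    ∑ s, (Δ.neighborFinset s ∩ Y).card * (Δ.neighborFinset s ∩ Z).card
      = ∑ y ∈ Y, ∑ z ∈ Z, (Δ.neighborFinset y ∩ Δ.neighborFinset z).card := by
  have e : ∀ (s : W) (A : Finset W), (Δ.neighborFinset s ∩ A).card
      = ∑ y ∈ A, if Δ.Adj s y then 1 else 0 := fun s A => by
    rw [sum_boole, Nat.cast_id]
    congr 1
    ext y
    simp [and_comm]
  have e' : ∀ y z : W, (Δ.neighborFinset y ∩ Δ.neighborFinset z).card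
      = ∑ s, (if Δ.Adj s y then 1 else 0) * (if Δ.Adj s z then 1 else 0) := fun y z => by
    simp only [← ite_and, mul_ite, mul_one, mul_zero]
    rw [sum_boole, Nat.cast_id]
    congr 1
    ext s
    simp [Δ.adj_comm, and_comm]
  simp only [e']
  simp only [e, sum_mul_sum]
  rw [sum_comm]
  exact sum_congr rfl fun y _ => sum_comm

/-- Two large anticomplete cliques contain large cliques completely joined to a third one. -/
theorem HasCliqueCommonNeighbors.exists_joined_cliques (hΔ : HasCliqueCommonNeighbors Δ μ)
    {n C D : ℕ} (hcov : CoveredByCliques Δ univ n) (hC : Fintype.card W ≤ C * μ)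
    (hpos : 0 < Fintype.card W) {Y Z : Finset W} (hY : Δ.IsClique (Y : Set W))
    (hZ : Δ.IsClique (Z : Set W)) (hYZ : ∀ y ∈ Y, ∀ z ∈ Z, y ≠ z ∧ ¬ Δ.Adj y z)
    (hYD : Fintype.card W ≤ D * Y.card) (hZD : Fintype.card W ≤ D * Z.card) :
    ∃ Y' ⊆ Y, ∃ Z' ⊆ Z, ∃ S : Finset W, Δ.IsClique (S : Set W) ∧
      (∀ s ∈ S, ∀ y ∈ Y', Δ.Adj s y) ∧ (∀ s ∈ S, ∀ z ∈ Z', Δ.Adj s z) ∧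
      Fintype.card W ≤ 2 * C * D * Y'.card ∧ Fintype.card W ≤ 2 * C * D * Z'.card ∧
      Fintype.card W ≤ 2 * C * n * S.card := by
  set k := Fintype.card W with hk
  have hYpos : 0 < Y.card := Nat.pos_of_ne_zero fun h => by rw [h] at hYD; omega
  have hZpos : 0 < Z.card := Nat.pos_of_ne_zero fun h => by rw [h] at hZD; omega
  have hsum : ∑ s, (Δ.neighborFinset s ∩ Y).card * (Δ.neighborFinset s ∩ Z).card
      = Y.card * (Z.card * μ) := by
    rw [sum_card_inter_mul_card_inter, ← smul_eq_mul, ← sum_const]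
    refine sum_congr rfl fun y hy => ?_
    rw [← smul_eq_mul, ← sum_const]
    exact sum_congr rfl fun z hz => hΔ.card (hYZ y hy z hz).1 (hYZ y hy z hz).2
  -- `R` collects the vertices for which the product is at least half its average over all vertices.
  -- A single product is at most `|Y||Z|`, so `R` has at least `μ / 2` elements; each of them sees a
  -- fixed proportion of `Y` and of `Z`.
  set R := univ.filter fun s => Y.card * (Z.card * μ) ≤
    2 * k * ((Δ.neighborFinset s ∩ Y).card * (Δ.neighborFinset s ∩ Z).card) with hR
  have hRμ : μ ≤ 2 * R.card := by
    have h1 : 2 * k * (Y.card * (Z.card * μ)) ≤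
        R.card * (2 * k * (Y.card * Z.card)) + k * (Y.card * (Z.card * μ)) := by
      have e : R.card * (2 * k * (Y.card * Z.card)) + k * (Y.card * (Z.card * μ)) =
          ∑ s, ((if Y.card * (Z.card * μ) ≤ 2 * k * ((Δ.neighborFinset s ∩ Y).card *
            (Δ.neighborFinset s ∩ Z).card) then 2 * k * (Y.card * Z.card) else 0)
            + Y.card * (Z.card * μ)) := by
        rw [sum_add_distrib, ← sum_filter, sum_const, sum_const, smul_eq_mul, smul_eq_mul,
          card_univ]
      rw [e, ← hsum, mul_sum]
      rw [hsum]
      refine sum_le_sum fun s _ => ?_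
      split_ifs with h
      · have := Nat.mul_le_mul (card_le_card (inter_subset_right (s₁ := Δ.neighborFinset s)
          (s₂ := Y))) (card_le_card (inter_subset_right (s₁ := Δ.neighborFinset s) (s₂ := Z)))
        exact (Nat.mul_le_mul_left _ this).trans (Nat.le_add_right _ _)
      · push Not at h
        omega
    have h2 : (k * (Y.card * Z.card)) * μ ≤ (k * (Y.card * Z.card)) * (2 * R.card) := by
      nlinarith
    exact Nat.le_of_mul_le_mul_left h2 (by positivity)
  have hμ : 0 < μ := Nat.pos_of_ne_zero fun h => by rw [h] at hC; omega
  have key : ∀ {y z a b : ℕ}, 0 < z → b ≤ z → y * (z * μ) ≤ 2 * k * (a * b) → k ≤ D * y →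
      k ≤ 2 * C * D * a := by
    intro y z a b hz hb h hD
    have h1 : z * (y * μ) ≤ z * (2 * k * a) := by
      calc z * (y * μ) = y * (z * μ) := by ring
        _ ≤ 2 * k * (a * b) := h
        _ ≤ 2 * k * (a * z) := by gcongr
        _ = _ := by ring
    have h2 := Nat.le_of_mul_le_mul_left h1 hz
    have h3 : k * k ≤ k * (2 * C * D * a) := by
      calc k * k ≤ (D * y) * (C * μ) := Nat.mul_le_mul hD hC
        _ = D * C * (y * μ) := by ring
        _ ≤ D * C * (2 * k * a) := by gcongr
        _ = _ := by ring
    exact Nat.le_of_mul_le_mul_left h3 hpos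
  have hRY : ∀ s ∈ R, k ≤ 2 * C * D * (Δ.neighborFinset s ∩ Y).card := fun s hs =>
    key hZpos (card_le_card inter_subset_right) (mem_filter.1 hs).2 hYD
  have hRZ : ∀ s ∈ R, k ≤ 2 * C * D * (Δ.neighborFinset s ∩ Z).card := fun s hs =>
    key hYpos (card_le_card (inter_subset_right (s₁ := Δ.neighborFinset s) (s₂ := Y)))
      (by have := (mem_filter.1 hs).2; nlinarith) hZD
  obtain ⟨𝒦, h𝒦, hcl, hc⟩ := hcov
  have hne : 𝒦.Nonempty := by
    obtain ⟨v⟩ := Fintype.card_pos_iff.1 hpos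
    obtain ⟨K, hK, -⟩ := hc v (mem_univ v)
    exact ⟨K, hK⟩
  obtain ⟨K, hK, hmax⟩ := exists_max_image 𝒦 (fun K => (K ∩ R).card) hne
  have hRS : R.card ≤ n * (K ∩ R).card := by
    have h1 : R ⊆ 𝒦.biUnion fun K => K ∩ R := fun s hs => by
      obtain ⟨K, hK, hsK⟩ := hc s (mem_univ s)
      exact mem_biUnion.2 ⟨K, hK, mem_inter.2 ⟨hsK, hs⟩⟩
    exact (card_le_card h1).trans ((card_biUnion_le_card_mul _ _ _ hmax).trans
      (Nat.mul_le_mul_right _ h𝒦))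
  have hSk : k ≤ 2 * C * n * (K ∩ R).card := by
    calc k ≤ C * μ := hC
      _ ≤ C * (2 * (n * (K ∩ R).card)) := by gcongr; omega
      _ = _ := by ring
  have hScl : Δ.IsClique ((K ∩ R : Finset W) : Set W) := (hcl K hK).subset (by simp)
  have hSne : (K ∩ R).Nonempty := by
    rw [← card_pos]
    exact Nat.pos_of_ne_zero fun h => by rw [h] at hSk; omega
  have hSY : Disjoint (K ∩ R) Y := by
    refine disjoint_left.2 fun s hs hsY => ?_
    have h1 := hRZ s (mem_inter.1 hs).2
    obtain ⟨z, hz⟩ := card_pos.1 (Nat.pos_of_ne_zero fun h => by rw [h] at h1; omega)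
    obtain ⟨hz1, hz2⟩ := mem_inter.1 hz
    exact (hYZ s hsY z hz2).2 (by simpa using hz1)
  have hSZ : Disjoint (K ∩ R) Z := by
    refine disjoint_left.2 fun s hs hsZ => ?_
    have h1 := hRY s (mem_inter.1 hs).2
    obtain ⟨y, hy⟩ := card_pos.1 (Nat.pos_of_ne_zero fun h => by rw [h] at h1; omega)
    obtain ⟨hy1, hy2⟩ := mem_inter.1 hy
    rw [SimpleGraph.mem_neighborFinset] at hy1
    exact (hYZ y hy2 s hsZ).2 hy1.symm
  -- The least trace on `Y` is joined to the whole clique `K ∩ R`, and it is still large because it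
  -- belongs to a vertex of `R`; the same holds for `Z`.
  obtain ⟨p, hp, hpY⟩ := hΔ.exists_least hScl hY hSY hSne
  obtain ⟨q, hq, hqZ⟩ := hΔ.exists_least hScl hZ hSZ hSne
  exact ⟨_, inter_subset_right, _, inter_subset_right, K ∩ R, hScl,
    fun s hs y hy => by simpa using (mem_inter.1 (hpY s hs hy)).1,
    fun s hs z hz => by simpa using (mem_inter.1 (hqZ s hs hz)).1,
    hRY p (mem_inter.1 hp).2, hRZ q (mem_inter.1 hq).2, hSk⟩

/-- Bound for the degree divided by `μ`. -/
def degreeRatio (m : ℕ) : ℕ := (m ^ 2) ^ 2 * ((m ^ 2) ^ 2 + 1)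

/-- Bound for the number of vertices divided by `μ`. -/
def cardRatio (m : ℕ) : ℕ := 1 + degreeRatio m + degreeRatio m ^ 2

/-- Bound for the number of cliques needed to cover all vertices. -/
def coverBound (m : ℕ) : ℕ := (m ^ 2 * cardRatio m) ^ 2

/-- Bound for the number of vertices of a regular non-complete graph with all eigenvalues at least
`-m` in which the common neighbours of two nonadjacent vertices form cliques of a fixed size. -/
def cardBound (m : ℕ) : ℕ :=
  (2 * cardRatio m * (8 * coverBound m ^ 2) + 2 * cardRatio m * coverBound m) * (3 * m)

/-- `μ`, the degree and the number of vertices agree up to factors depending on `m`. Counting edges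
then bounds independent sets, so boundedly many cliques cover the graph, and the three joined
cliques have size a fixed fraction of the number of vertices. Trimmed to a common size, they have at
most `3 * m` vertices each. -/
theorem HasCliqueCommonNeighbors.card_le (hΔ : HasCliqueCommonNeighbors Δ μ) (hμ : 1 ≤ μ)
    {m a : ℕ} (hm : 1 ≤ m) (hreg : ∀ v, (Δ.neighborFinset v).card = a)
    (hform : ∀ f : W → ℝ, -(m : ℝ) * ∑ v, f v ^ 2 ≤ adjForm Δ f) {y z : W} (hyz : y ≠ z)
    (hnadj : ¬ Δ.Adj y z) : Fintype.card W ≤ cardBound m := by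
  have hpos : 0 < Fintype.card W := Fintype.card_pos_iff.2 ⟨y⟩
  have hclaw : ∀ (y : W) (I : Finset W), I ⊆ Δ.neighborFinset y →
      (∀ u ∈ I, ∀ v ∈ I, ¬ Δ.Adj u v) → I.card ≤ m ^ 2 :=
    fun y I hI hind => card_le_sq_of_independent hm hform hI hind
  have hloc : ∀ w, CoveredByCliques Δ (Δ.neighborFinset w) ((m ^ 2) ^ 2) :=
    fun w => hΔ.coveredByCliques (hclaw w)
  have ha : a ≤ degreeRatio m * μ := by
    rw [degreeRatio, mul_assoc]
    exact hΔ.degree_le hμ hloc hreg hyz hnadj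
  have hμa : μ ≤ a := by
    rw [← hΔ.card hyz hnadj, ← hreg y]
    exact card_le_card inter_subset_left
  have hd := card_compl_neighborFinset hreg
  have hk : Fintype.card W ≤ cardRatio m * μ := by
    have h1 := hΔ.card_compl_mul_le hreg y
    rw [hd] at h1
    have h2 : (Fintype.card W - 1 - a) * μ ≤ (degreeRatio m ^ 2 * μ) * μ := by
      calc _ ≤ a * a := h1
        _ ≤ (degreeRatio m * μ) * (degreeRatio m * μ) := Nat.mul_le_mul ha ha
        _ = _ := by ring
    have h3 := Nat.le_of_mul_le_mul_right h2 hμ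
    have h4 : cardRatio m * μ = μ + degreeRatio m * μ + degreeRatio m ^ 2 * μ := by
      rw [cardRatio]; ring
    omega
  have hcov : CoveredByCliques Δ univ (coverBound m) := by
    refine hΔ.coveredByCliques fun I _ hind => ?_
    have h1 := card_independent_mul_le hreg hclaw hind
    have h2 : I.card * a ≤ (m ^ 2 * cardRatio m) * a := by
      calc _ ≤ m ^ 2 * Fintype.card W := h1
        _ ≤ m ^ 2 * (cardRatio m * a) := by gcongr; exact hk.trans (Nat.mul_le_mul_left _ hμa)
        _ = _ := by ring
    exact Nat.le_of_mul_le_mul_right h2 (by omega)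
  obtain ⟨Y, Z, hY, hZ, hYZ, hYD, hZD⟩ := hΔ.exists_anticomplete hcov hd
    (hΔ.card_le_four_mul hreg hyz hnadj) hpos
  obtain ⟨Y', hY', Z', hZ', S, hS, hSY, hSZ, h1, h2, h3⟩ :=
    hΔ.exists_joined_cliques hcov hk hpos hY hZ hYZ hYD hZD
  obtain ⟨n, hnY, hnZ, hnS, hn⟩ : ∃ n, n ≤ Y'.card ∧ n ≤ Z'.card ∧ n ≤ S.card ∧
      (n = Y'.card ∨ n = Z'.card ∨ n = S.card) :=
    ⟨min Y'.card (min Z'.card S.card), by omega, by omega, by omega, by omega⟩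
  obtain ⟨Y₀, hY₀, hY₀n⟩ := exists_subset_card_eq hnY
  obtain ⟨Z₀, hZ₀, hZ₀n⟩ := exists_subset_card_eq hnZ
  obtain ⟨S₀, hS₀, hS₀n⟩ := exists_subset_card_eq hnS
  have hn3 : n ≤ 3 * m := card_le_of_joined_cliques hform
    (hY.subset (coe_subset.2 (hY₀.trans hY'))) (hZ.subset (coe_subset.2 (hZ₀.trans hZ')))
    (hS.subset (coe_subset.2 hS₀))
    (fun y hy z hz => hYZ y (hY' (hY₀ hy)) z (hZ' (hZ₀ hz)))
    (fun s hs y hy => hSY s (hS₀ hs) y (hY₀ hy)) (fun s hs z hz => hSZ s (hS₀ hs) z (hZ₀ hz))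
    hY₀n hZ₀n hS₀n
  refine le_trans ?_ (Nat.mul_le_mul_left _ hn3)
  rw [add_mul]
  rcases hn with rfl | rfl | rfl <;> omega

end ValencyBound

/-! ### From an eigenvalue of the graph to the eigenvalues of its local graphs. -/

open Polynomial

section LocalForm

variable {W : Type*} [Fintype W] {Δ : SimpleGraph W} [DecidableRel Δ.Adj]

/-- In a regular graph, a lower bound for the adjacency form on vectors with sum zero holds for all
vectors. -/
theorem adjForm_ge_of_regular {a : ℕ} {m : ℝ} (hm : 0 ≤ m)
    (hreg : ∀ v, (Δ.neighborFinset v).card = a)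
    (h : ∀ g : W → ℝ, ∑ v, g v = 0 → -m * ∑ v, g v ^ 2 ≤ adjForm Δ g) (f : W → ℝ) :
    -m * ∑ v, f v ^ 2 ≤ adjForm Δ f := by
  rcases isEmpty_or_nonempty W with hW | hW
  · simp [adjForm]
  have hk : (0 : ℝ) < Fintype.card W := by exact_mod_cast Fintype.card_pos
  set r : ℝ := (∑ v, f v) / Fintype.card W with hr
  set g : W → ℝ := fun v => f v - r with hg
  have hf : ∀ v, f v = g v + r := fun v => by simp [hg]
  have hsum : ∑ v, g v = 0 := by
    simp only [hg, sum_sub_distrib, sum_const, card_univ, nsmul_eq_mul, hr]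
    field_simp
    ring
  have hdeg : ∑ v, ∑ w ∈ Δ.neighborFinset v, g w = 0 := by
    have e : ∀ v, ∑ w ∈ Δ.neighborFinset v, g w = ∑ w, if Δ.Adj v w then g w else 0 := fun v => by
      rw [← sum_filter]
      congr 1
      ext w
      simp
    simp only [e]
    rw [sum_comm]
    have e2 : ∀ w, ∑ v, (if Δ.Adj v w then g w else 0) = a * g w := fun w => by
      rw [← sum_filter, sum_const, nsmul_eq_mul, ← hreg w]
      congr 3
      ext v
      simp [Δ.adj_comm]
    simp only [e2, ← mul_sum, hsum, mul_zero]
  have h1 : adjForm Δ f = adjForm Δ g + r ^ 2 * a * Fintype.card W := by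
    have : ∀ v, f v * ∑ w ∈ Δ.neighborFinset v, f w = g v * ∑ w ∈ Δ.neighborFinset v, g w
        + r * ∑ w ∈ Δ.neighborFinset v, g w + a * r * g v + r ^ 2 * a := fun v => by
      simp only [hf, sum_add_distrib, sum_const, hreg, nsmul_eq_mul]
      ring
    simp only [adjForm, this, sum_add_distrib, ← mul_sum, hdeg, hsum, sum_const, card_univ,
      nsmul_eq_mul]
    ring
  have h2 : ∑ v, f v ^ 2 = ∑ v, g v ^ 2 + r ^ 2 * Fintype.card W := by
    have : ∀ v, f v ^ 2 = g v ^ 2 + 2 * r * g v + r ^ 2 := fun v => by rw [hf]; ring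
    simp only [this, sum_add_distrib, ← mul_sum, hsum, sum_const, card_univ, nsmul_eq_mul]
    ring
  have h3 := h g hsum
  rw [h1, h2]
  have h4 : 0 ≤ r ^ 2 * a * Fintype.card W := by positivity
  have h5 : 0 ≤ m * (r ^ 2 * Fintype.card W) := by positivity
  linarith

/-- A positive semidefinite form that only distinguishes equal, adjacent and nonadjacent pairs
gives a lower bound for the adjacency form. -/
theorem adjForm_ge_of_gram [DecidableEq W] {V : Type*} [Fintype V] {ι : W → V} {P : V → V → ℝ}
    {e₀ e₁ e₂ m : ℝ}
    (h₀ : ∀ u, ∑ w, P w (ι u) * P w (ι u) = e₀)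
    (h₁ : ∀ u v, Δ.Adj u v → ∑ w, P w (ι u) * P w (ι v) = e₁)
    (h₂ : ∀ u v, u ≠ v → ¬ Δ.Adj u v → ∑ w, P w (ι u) * P w (ι v) = e₂) (he : e₂ < e₁)
    (hm : e₀ - e₂ ≤ m * (e₁ - e₂)) (g : W → ℝ) (hg : ∑ v, g v = 0) :
    -m * ∑ v, g v ^ 2 ≤ adjForm Δ g := by
  -- The Gram matrix is `e₂ J + (e₀ - e₂) I + (e₁ - e₂) A`, and the all-ones matrix `J` vanishes on
  -- vectors with sum zero.
  have hentry : ∀ u v, ∑ w, P w (ι u) * P w (ι v) =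
      e₂ + (if u = v then e₀ - e₂ else 0) + (if Δ.Adj u v then e₁ - e₂ else 0) := by
    intro u v
    by_cases huv : u = v
    · subst huv
      simp [h₀]
    · by_cases hadj : Δ.Adj u v
      · simp [h₁ u v hadj, huv, hadj]
      · simp [h₂ u v huv hadj, huv, hadj]
  have hpsd : 0 ≤ ∑ u, ∑ v, g u * g v * ∑ w, P w (ι u) * P w (ι v) := by
    have : ∑ u, ∑ v, g u * g v * ∑ w, P w (ι u) * P w (ι v) = ∑ w, (∑ u, P w (ι u) * g u) ^ 2 := by
      simp only [sq, mul_sum]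
      refine ((sum_congr rfl fun u _ => sum_comm).trans sum_comm).trans
        (sum_congr rfl fun w _ => ?_)
      rw [← mul_sum, sum_mul_sum]
      exact sum_congr rfl fun u _ => sum_congr rfl fun v _ => by ring
    rw [this]
    exact sum_nonneg fun w _ => sq_nonneg _
  have heq : ∑ u, ∑ v, g u * g v * ∑ w, P w (ι u) * P w (ι v)
      = (e₀ - e₂) * ∑ v, g v ^ 2 + (e₁ - e₂) * adjForm Δ g := by
    have h1 : ∀ u, ∑ v, g u * g v * ∑ w, P w (ι u) * P w (ι v) =
        (e₀ - e₂) * g u ^ 2 + (e₁ - e₂) * (g u * ∑ v ∈ Δ.neighborFinset u, g v) := by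
      intro u
      have h2 : ∑ v ∈ Δ.neighborFinset u, g v = ∑ v, if Δ.Adj u v then g v else 0 := by
        rw [← sum_filter]
        congr 1
        ext w
        simp
      have h3 : ∀ v, g u * g v * ∑ w, P w (ι u) * P w (ι v) = e₂ * g u * g v
          + (if u = v then (e₀ - e₂) * g u * g v else 0)
          + (e₁ - e₂) * g u * (if Δ.Adj u v then g v else 0) := by
        intro v
        rw [hentry]
        split_ifs <;> ring
      simp only [h3, h2, sum_add_distrib, ← mul_sum, hg, sum_ite_eq, mem_univ, if_true]
      ring
    simp only [h1, sum_add_distrib, ← mul_sum, adjForm]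
  rw [heq] at hpsd
  have hs : 0 ≤ ∑ v, g v ^ 2 := sum_nonneg fun v _ => sq_nonneg _
  have h6 := mul_le_mul_of_nonneg_right hm hs
  have h7 : 0 ≤ (e₁ - e₂) * (m * ∑ v, g v ^ 2 + adjForm Δ g) := by nlinarith
  have h8 := nonneg_of_mul_nonneg_right h7 (sub_pos.2 he)
  linarith

end LocalForm

section Spectral

variable {V : Type*} [Fintype V] {G : SimpleGraph V} [DecidableRel G.Adj] {b c : ℕ → ℕ} {θ : ℝ}

theorem IsDistanceRegularWith.card_neighborFinset (hG : IsDistanceRegularWith G b c) (v : V) :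
    (G.neighborFinset v).card = b 0 := by
  have h := hG.ncard_farther v v
  rw [SimpleGraph.dist_self] at h
  rw [← h, ← Set.ncard_coe_finset]
  congr 1
  ext z
  simp [farther]

/-- The three-term recurrence, with the neighbours at equal distance eliminated through `a_i = b 0 -
b i - c i`. At distance zero the truncated `0 - 1` makes the last term vanish. -/
theorem IsDistanceRegularWith.sum_neighborFinset (hG : IsDistanceRegularWith G b c) (e : ℕ → ℝ)
    (u v : V) : ∑ w ∈ G.neighborFinset v, e (G.dist u w) =
      b 0 * e (G.dist u v) + b (G.dist u v) * (e (G.dist u v + 1) - e (G.dist u v))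
        + c (G.dist u v) * (e (G.dist u v - 1) - e (G.dist u v)) := by
  classical
  have hc := hG.1
  set i := G.dist u v with hi
  have h1 : ∀ w ∈ G.neighborFinset v, e (G.dist u w) = e i
      + (if G.dist u w = i + 1 then e (i + 1) - e i else 0)
      + (if G.dist u w + 1 = i then e (i - 1) - e i else 0) := by
    intro w hw
    rw [SimpleGraph.mem_neighborFinset] at hw
    have l1 := dist_le_succ_of_adj hc u hw
    have l2 := dist_le_succ_of_adj hc u hw.symm
    rcases lt_trichotomy (G.dist u w) i with h | h | h
    · have h' : G.dist u w = i - 1 := by omega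
      rw [if_neg (by omega), if_pos (by omega), h']
      ring
    · rw [if_neg (by omega), if_neg (by omega), h]
      ring
    · have h' : G.dist u w = i + 1 := by omega
      rw [if_pos h', if_neg (by omega), h']
      ring
  have hb : ((G.neighborFinset v).filter fun w => G.dist u w = i + 1).card = b i := by
    rw [hi, ← hG.ncard_farther, ← Set.ncard_coe_finset]
    congr 1
    ext w
    simp [farther]
  have hcc : ((G.neighborFinset v).filter fun w => G.dist u w + 1 = i).card = c i := by
    rw [hi, ← hG.ncard_nearer, ← Set.ncard_coe_finset]
    congr 1
    ext w
    simp [nearer]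
  rw [sum_congr rfl h1, sum_add_distrib, sum_add_distrib, ← sum_filter, ← sum_filter, sum_const,
    sum_const, sum_const, hb, hcc, hG.card_neighborFinset]
  simp only [nsmul_eq_mul]

/-- The entries of a polynomial in the adjacency matrix depend on the distance only. -/
theorem IsDistanceRegularWith.exists_aeval_apply_eq [DecidableEq V]
    (hG : IsDistanceRegularWith G b c) (p : ℝ[X]) :
    ∃ e : ℕ → ℝ, ∀ u v, aeval (G.adjMatrix ℝ) p u v = e (G.dist u v) := by
  induction p using Polynomial.induction_on with
  | C r =>
    refine ⟨fun n => if n = 0 then r else 0, fun u v => ?_⟩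
    rw [aeval_C, Matrix.algebraMap_matrix_apply]
    simp [hG.1.dist_eq_zero_iff]
  | add p q hp hq =>
    obtain ⟨e, he⟩ := hp
    obtain ⟨e', he'⟩ := hq
    exact ⟨fun n => e n + e' n, fun u v => by rw [map_add, Matrix.add_apply, he, he']⟩
  | monomial n r h =>
    obtain ⟨e, he⟩ := h
    refine ⟨fun i => b 0 * e i + b i * (e (i + 1) - e i) + c i * (e (i - 1) - e i),
      fun u v => ?_⟩
    rw [pow_succ, ← mul_assoc, map_mul, aeval_X, SimpleGraph.mul_adjMatrix_apply]
    simp only [he]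
    exact hG.sum_neighborFinset e u v

theorem IsEigenvalue.hasEigenvalue [DecidableEq V] (h : IsEigenvalue G θ) :
    Module.End.HasEigenvalue (Matrix.toLin' (G.adjMatrix ℝ)) θ := by
  unfold IsEigenvalue at h
  convert h

/-- A nonzero Gram matrix whose rows are eigenvectors and whose entries depend on the distance. -/
theorem IsDistanceRegularWith.exists_gram [DecidableEq V] (hG : IsDistanceRegularWith G b c)
    (hθ : IsEigenvalue G θ) : ∃ (P : V → V → ℝ) (e : ℕ → ℝ),
      (∀ u v, ∑ w, P w u * P w v = e (G.dist u v)) ∧ 0 < e 0 ∧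
      ∀ u v, ∑ w ∈ G.neighborFinset v, e (G.dist u w) = θ * e (G.dist u v) := by
  set A := G.adjMatrix ℝ with hA
  have hroot : (minpoly ℝ A).IsRoot θ := by
    rw [← Matrix.minpoly_toLin']
    exact Module.End.isRoot_of_hasEigenvalue hθ.hasEigenvalue
  have hfac := mul_divByMonic_eq_iff_isRoot.2 hroot
  -- `q(A)` is a nonzero multiple of the orthogonal projection onto the `θ`-eigenspace: it is
  -- nonzero by minimality, and `(A - θ) q(A) = 0`.
  set q := minpoly ℝ A /ₘ (X - C θ) with hq
  have hint : IsIntegral ℝ A := Algebra.IsIntegral.isIntegral A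
  have hmin := minpoly.ne_zero hint
  have hq0 : q ≠ 0 := fun h => hmin (by rw [← hfac, h, mul_zero])
  have hP0 : aeval A q ≠ 0 := by
    intro h
    have h1 := natDegree_le_of_dvd (minpoly.dvd ℝ A h) hq0
    rw [← hfac, natDegree_mul (X_sub_C_ne_zero θ) hq0, natDegree_X_sub_C] at h1
    omega
  obtain ⟨p, hp⟩ := hG.exists_aeval_apply_eq q
  obtain ⟨e, he⟩ := hG.exists_aeval_apply_eq (q * q)
  rw [← hA] at hp he
  have hgram : ∀ u v, ∑ w, aeval A q w u * aeval A q w v = e (G.dist u v) := by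
    intro u v
    rw [← he, map_mul, Matrix.mul_apply]
    refine sum_congr rfl fun w _ => ?_
    rw [hp w u, G.dist_comm, ← hp u w]
  refine ⟨fun u v => aeval A q u v, e, hgram, ?_, ?_⟩
  · have hdiag : ∀ u, ∑ w, aeval A q w u * aeval A q w u = e 0 := fun u => by
      rw [hgram, SimpleGraph.dist_self]
    obtain ⟨x⟩ := hG.1.nonempty
    refine lt_of_le_of_ne ?_ fun h0 => hP0 ?_
    · rw [← hdiag x]
      exact sum_nonneg fun w _ => mul_self_nonneg _
    · ext w u
      have h1 := hdiag u
      rw [← h0, sum_eq_zero_iff_of_nonneg fun w _ => mul_self_nonneg _] at h1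
      simpa using h1 w (mem_univ w)
  · intro u v
    have h1 : aeval A (q * q) * A = θ • aeval A (q * q) := by
      have h2 : aeval A ((X - C θ) * q) = 0 := by rw [hfac, minpoly.aeval]
      have h3 : aeval A (q * q * X - C θ * (q * q)) = 0 := by
        rw [show q * q * X - C θ * (q * q) = q * ((X - C θ) * q) by ring, map_mul, h2, mul_zero]
      rw [map_sub, map_mul _ (q * q) X, aeval_X, map_mul _ (C θ), aeval_C, sub_eq_zero] at h3
      rw [h3, Algebra.smul_def]
    have h2 := congrFun (congrFun h1 u) v
    rw [hA, SimpleGraph.mul_adjMatrix_apply, ← hA, Matrix.smul_apply, smul_eq_mul] at h2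
    simpa only [he] using h2

/-- Gershgorin: the diagonal is zero and each row sums to the valency. -/
theorem IsDistanceRegularWith.eigenvalue_le [DecidableEq V] (hG : IsDistanceRegularWith G b c)
    (hθ : IsEigenvalue G θ) : θ ≤ b 0 := by
  obtain ⟨v, hv⟩ := eigenvalue_mem_ball hθ.hasEigenvalue
  rw [Metric.mem_closedBall, Real.dist_eq, SimpleGraph.adjMatrix_apply,
    if_neg (G.loopless.irrefl v), sub_zero] at hv
  refine (le_abs_self θ).trans (hv.trans ?_)
  rw [← hG.card_neighborFinset v]
  calc ∑ j ∈ univ.erase v, ‖G.adjMatrix ℝ v j‖ ≤ ∑ j, ‖G.adjMatrix ℝ v j‖ :=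
        sum_le_sum_of_subset_of_nonneg (erase_subset _ _) fun _ _ _ => norm_nonneg _
    _ = ((G.neighborFinset v).card : ℝ) := by
        rw [show G.neighborFinset v = univ.filter fun w => G.Adj v w by ext; simp, ← sum_boole]
        refine sum_congr rfl fun w _ => ?_
        rw [SimpleGraph.adjMatrix_apply]
        split_ifs <;> simp

end Spectral

theorem dist_eq_two_of_common_neighbor {V : Type*} {G : SimpleGraph V} (hc : G.Connected)
    {x y z : V} (hy : G.Adj x y) (hz : G.Adj x z) (hne : y ≠ z) (hnadj : ¬ G.Adj y z) :
    G.dist y z = 2 := by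
  have h1 := dist_le_succ_of_adj hc y hz
  rw [SimpleGraph.dist_eq_one_iff_adj.2 hy.symm] at h1
  have h2 : G.dist y z ≠ 0 := fun h => hne (hc.dist_eq_zero_iff.1 h)
  have h3 : G.dist y z ≠ 1 := fun h => hnadj (SimpleGraph.dist_eq_one_iff_adj.1 h)
  omega

theorem IsDistanceRegularWith.c_one {V : Type*} {G : SimpleGraph V} {b c : ℕ → ℕ}
    (hG : IsDistanceRegularWith G b c) {x y : V} (h : G.Adj x y) : c 1 = 1 := by
  have hxy := SimpleGraph.dist_eq_one_iff_adj.2 h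
  have hcard := hG.ncard_nearer x y
  rw [hxy] at hcard
  rw [← hcard, Set.ncard_eq_one]
  refine ⟨x, Set.ext fun z => ⟨fun hz => ?_, ?_⟩⟩
  · have := hz.2
    exact (hG.1.dist_eq_zero_iff.1 (by omega)).symm
  · rintro rfl
    exact ⟨h.symm, by rw [SimpleGraph.dist_self, hxy]⟩

section LocalGraph

variable {V : Type*} [Fintype V] {G : SimpleGraph V} [DecidableRel G.Adj] {b c : ℕ → ℕ} {θ : ℝ}

theorem IsDistanceRegularWith.card_local_neighborFinset (hG : IsDistanceRegularWith G b c) (x : V)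
    (y : G.neighborSet x) :
    ((G.induce (G.neighborSet x)).neighborFinset y).card = b 0 - b 1 - c 1 := by
  have hxy := SimpleGraph.dist_eq_one_iff_adj.2 y.2
  have h1 : ((G.induce (G.neighborSet x)).neighborFinset y).card =
      ((G.neighborFinset y).filter fun w => G.dist x w = 1).card := by
    rw [← card_map (Function.Embedding.subtype _)]
    congr 1
    ext w
    simp [SimpleGraph.dist_eq_one_iff_adj, and_comm]
  have h2 := hG.sum_neighborFinset (fun n => if n = 1 then 1 else 0) x y
  rw [sum_boole, ← h1, hxy] at h2
  simp only [if_true, Nat.reduceAdd, Nat.reduceSub, OfNat.ofNat_ne_one, zero_ne_one,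
    if_false] at h2
  have h3 : ((((G.induce (G.neighborSet x)).neighborFinset y).card + b 1 + c 1 : ℕ) : ℝ)
      = (b 0 : ℕ) := by
    push_cast
    linarith
  have h4 := Nat.cast_injective h3
  omega

/-- The eigenvalues of the local graphs are bounded below in terms of an eigenvalue of the graph. -/
theorem IsDistanceRegularWith.local_adjForm_ge [DecidableEq V] (hG : IsDistanceRegularWith G b c)
    (hθ : IsEigenvalue G θ) (hlt : θ < b 0) (hb : 0 < b 1) {T : ℝ} (hT : 1 ≤ T)
    (hθT : (b 1 : ℝ) / T - 1 ≤ θ) (x : V) (f : G.neighborSet x → ℝ) :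
    -(1 + T) * ∑ v, f v ^ 2 ≤ adjForm (G.induce (G.neighborSet x)) f := by
  refine adjForm_ge_of_regular (by linarith) (hG.card_local_neighborFinset x) ?_ f
  intro g hg
  rcases isEmpty_or_nonempty (G.neighborSet x) with hW | ⟨⟨y, hy⟩⟩
  · simp [adjForm]
  obtain ⟨P, e, hP, he0, hsum⟩ := hG.exists_gram hθ
  have hT0 : 0 < T := by linarith
  have hb' : (0 : ℝ) < b 1 := by exact_mod_cast hb
  have hθ1 : (b 1 : ℝ) ≤ T * (1 + θ) := by
    have := (div_le_iff₀ hT0).1 (show (b 1 : ℝ) / T ≤ 1 + θ by linarith)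
    linarith
  have hθ0 : 0 < 1 + θ := by
    by_contra h
    nlinarith
  have h0 := hsum x x
  rw [hG.sum_neighborFinset, SimpleGraph.dist_self] at h0
  simp only [zero_add, Nat.zero_sub, sub_self, mul_zero, add_zero] at h0
  have h1 := hsum x y
  rw [hG.sum_neighborFinset, SimpleGraph.dist_eq_one_iff_adj.2 hy, hG.c_one hy] at h1
  norm_num at h1
  have h10 : e 1 < e 0 := by
    by_contra h
    push Not at h
    have h2 : (b 0 : ℝ) * e 0 ≤ b 0 * e 1 := mul_le_mul_of_nonneg_left h (Nat.cast_nonneg _)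
    have h3 := mul_lt_mul_of_pos_right hlt he0
    linarith
  -- `h0` reads `b 0 * e 1 = θ * e 0`; substituting it into the recurrence at distance one gives
  -- this relation. Hence `(e 0 - e 2) / (e 1 - e 2) = 1 + b 1 / (1 + θ) ≤ 1 + T`.
  have hrel : b 1 * (e 1 - e 2) = (1 + θ) * (e 0 - e 1) := by linarith
  have h21 : e 2 < e 1 := by
    have : 0 < b 1 * (e 1 - e 2) := by
      rw [hrel]
      exact mul_pos hθ0 (by linarith)
    have := pos_of_mul_pos_right this hb'.le
    linarith
  refine adjForm_ge_of_gram (ι := Subtype.val) (P := P) (e₀ := e 0) (e₁ := e 1) (e₂ := e 2)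
    (fun u => ?_) (fun u v huv => ?_) (fun u v hne huv => ?_) h21 ?_ g hg
  · rw [hP, SimpleGraph.dist_self]
  · rw [hP, SimpleGraph.dist_eq_one_iff_adj.2 (show G.Adj u v from huv)]
  · rw [hP, dist_eq_two_of_common_neighbor hG.1 u.2 v.2 (fun h => hne (Subtype.ext h)) huv]
  · have h3 : b 1 * (e 0 - e 1) ≤ b 1 * (T * (e 1 - e 2)) := by
      calc b 1 * (e 0 - e 1) ≤ T * (1 + θ) * (e 0 - e 1) :=
            mul_le_mul_of_nonneg_right hθ1 (by linarith)
        _ = T * (b 1 * (e 1 - e 2)) := by rw [hrel]; ring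
        _ = _ := by ring
    have := le_of_mul_le_mul_left h3 hb'
    linarith

/-- The local graphs of a Terwilliger graph inherit the common neighbour property. -/
theorem hasCliqueCommonNeighbors_local [DecidableEq V] (hc : G.Connected) {μ : ℕ}
    (hμ : ∀ u v : V, G.dist u v = 2 →
      G.IsClique (G.commonNeighbors u v) ∧ (G.commonNeighbors u v).ncard = μ) (x : V) :
    HasCliqueCommonNeighbors (G.induce (G.neighborSet x)) (μ - 1) where
  adj := by
    intro y z p q hne hnadj h1 h2 h3 h4 hpq
    have hd := dist_eq_two_of_common_neighbor hc y.2 z.2 (fun h => hne (Subtype.ext h)) hnadj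
    exact (hμ _ _ hd).1 ⟨h1, h2⟩ ⟨h3, h4⟩ fun h => hpq (Subtype.ext h)
  card := by
    intro y z hne hnadj
    have hd := dist_eq_two_of_common_neighbor hc y.2 z.2 (fun h => hne (Subtype.ext h)) hnadj
    obtain ⟨hcl, hcard⟩ := hμ _ _ hd
    have hx : x ∈ G.commonNeighbors (y : V) z := ⟨y.2.symm, z.2.symm⟩
    rw [← hcard, ← Set.ncard_sdiff_singleton_of_mem hx,
      ← card_map (Function.Embedding.subtype _), ← Set.ncard_coe_finset]
    congr 1
    ext w
    simp only [coe_map, Function.Embedding.subtype_apply, coe_inter,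
      SimpleGraph.coe_neighborFinset, Set.mem_image, Set.mem_inter_iff, Set.mem_sdiff,
      Set.mem_singleton_iff]
    constructor
    · rintro ⟨p, ⟨h1, h2⟩, rfl⟩
      exact ⟨⟨h1, h2⟩, fun h => p.2.ne h.symm⟩
    · rintro ⟨hw, hwx⟩
      exact ⟨⟨w, hcl hx hw (Ne.symm hwx)⟩, ⟨hw.1, hw.2⟩, rfl⟩

end LocalGraph

/-! ### The valency bound and finiteness. -/

theorem exists_dist_eq_two {V : Type*} {G : SimpleGraph V} (hc : G.Connected) (h : G ≠ ⊤) :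
    ∃ x y, G.dist x y = 2 := by
  obtain ⟨x, y, hne, hnadj⟩ : ∃ x y, x ≠ y ∧ ¬ G.Adj x y := by
    by_contra hcon
    push Not at hcon
    refine h (SimpleGraph.ext (funext fun x => funext fun y => propext ⟨fun h => h.ne, hcon x y⟩))
  have h2 : G.dist x y ≠ 0 := fun h => hne (hc.dist_eq_zero_iff.1 h)
  have h3 : G.dist x y ≠ 1 := fun h => hnadj (SimpleGraph.dist_eq_one_iff_adj.1 h)
  exact exists_dist_eq_of_le hc ⟨x, y, rfl⟩ (by omega)

/-- The valency of a distance-regular Terwilliger graph with `c₂ ≥ 2` is bounded in terms of its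
second largest eigenvalue. -/
theorem valency_le {V : Type*} [Fintype V] {G : SimpleGraph V} {b c : ℕ → ℕ} {θ T : ℝ}
    (hT : 1 ≤ T) (hG : IsDistanceRegularWith G b c) (hter : IsTerwilliger G) (hc2 : 2 ≤ c 2)
    (hθ : IsSecondLargestEigenvalue G θ) (hθT : (b 1 : ℝ) / T - 1 ≤ θ) :
    b 0 ≤ cardBound ⌈1 + T⌉₊ := by
  classical
  obtain ⟨hc, htop, μ, hμ1, hμ⟩ := hter
  obtain ⟨⟨hθe, s, hs, hθs⟩, -⟩ := hθ
  obtain ⟨y, z, hyz⟩ := exists_dist_eq_two hc htop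
  have hμc : μ = c 2 := by
    rw [← (hμ y z hyz).2, ← hyz, ← hG.ncard_nearer]
    congr 1
    ext w
    refine ⟨fun hw => ⟨hw.2, by rw [SimpleGraph.dist_eq_one_iff_adj.2 hw.1, hyz]⟩, fun hw => ?_⟩
    have := hw.2
    exact ⟨SimpleGraph.dist_eq_one_iff_adj.1 (by omega), hw.1⟩
  obtain ⟨x, hx⟩ : (G.commonNeighbors y z).Nonempty := by
    rw [← Set.ncard_pos (Set.toFinite _), (hμ y z hyz).2]
    exact hμ1
  have hne : y ≠ z := by
    rintro rfl
    simp at hyz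
  have hnadj : ¬ G.Adj y z := fun h => by
    rw [SimpleGraph.dist_eq_one_iff_adj.2 h] at hyz
    omega
  have hlt : θ < b 0 := hθs.trans_le (hG.eigenvalue_le hs)
  have hform : ∀ f : G.neighborSet x → ℝ,
      -((⌈1 + T⌉₊ : ℕ) : ℝ) * ∑ v, f v ^ 2 ≤ adjForm (G.induce (G.neighborSet x)) f := by
    intro f
    refine le_trans ?_ (hG.local_adjForm_ge hθe hlt (hG.b_pos ⟨y, z, hyz⟩ (by omega)) hT hθT x f)
    exact mul_le_mul_of_nonneg_right (neg_le_neg (Nat.le_ceil _))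
      (sum_nonneg fun v _ => sq_nonneg _)
  -- The local parameter is `μ - 1`, which is positive because `μ = c 2 ≥ 2`. The vertices `y` and
  -- `z` show that the local graph at their common neighbour `x` is not complete.
  have h := (hasCliqueCommonNeighbors_local hc hμ x).card_le (by omega)
    (Nat.one_le_ceil_iff.2 (by linarith)) (hG.card_local_neighborFinset x) hform
    (y := ⟨y, hx.1.symm⟩) (z := ⟨z, hx.2.symm⟩) (fun h => hne (congrArg Subtype.val h)) hnadj
  rwa [SimpleGraph.card_neighborSet_eq_degree, ← SimpleGraph.card_neighborFinset_eq_degree,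
    hG.card_neighborFinset] at h

end DRG

theorem proposition8 (T : ℝ) (hT : 1 ≤ T) :
    ∃ S : Finset (Σ n : ℕ, SimpleGraph (Fin n)),
      ∀ (V : Type*) [Fintype V] (G : SimpleGraph V) (b c : ℕ → ℕ) (θ : ℝ),
        DRG.IsDistanceRegularWith G b c → DRG.IsTerwilliger G → 2 ≤ c 2 →
        DRG.IsSecondLargestEigenvalue G θ → (b 1 : ℝ) / T - 1 ≤ θ →
        ∃ H ∈ S, Nonempty (G ≃g H.2) := by
  classical
  set F := DRG.cardBound ⌈1 + T⌉₊
  set N := (F + 1) ^ 3 ^ (2 * F + 1)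
  refine ⟨(Finset.range (N + 1)).sigma fun _ => Finset.univ, ?_⟩
  intro V _ G b c θ hG hter hc2 hθ hθT
  have hb : b 0 ≤ F := DRG.valency_le hT hG hter hc2 hθ hθT
  have hcard : Fintype.card V ≤ N := by
    rw [← Nat.card_eq_fintype_card]
    calc Nat.card V ≤ (b 0 + 1) ^ 3 ^ (2 * b 0 + 1) :=
          DRG.card_le_of_dist_lt hG (DRG.dist_lt_of_two_le_c_two hG hc2)
      _ ≤ (F + 1) ^ 3 ^ (2 * b 0 + 1) := Nat.pow_le_pow_left (by omega) _
      _ ≤ N := Nat.pow_le_pow_right (by omega) (Nat.pow_le_pow_right (by omega) (by omega))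
  exact ⟨⟨Fintype.card V, G.map (Fintype.equivFin V).toEmbedding⟩,
    Finset.mem_sigma.2 ⟨Finset.mem_range.2 (Nat.lt_succ_of_le hcard), Finset.mem_univ _⟩,
    ⟨SimpleGraph.Iso.map (Fintype.equivFin V) G⟩⟩
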